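/- Let $0\le m\le n$ and let $F(x,\dot x)=0$ be a system of $n-m$ equations, where $F$ is an $\mathbb R^{n-m}$-valued real-analytic function on an open set $\Omega\subseteq\mathbb R^n\times\mathbb R^n$ (for instance $\Omega=X\times\mathbb R^n$ with $X$ an open set of $\mathbb R^n$). Let $\mathfrak X=\mathbb R^n\times\mathbb R^n\times\cdots$ be the space of jets $\bar x=(x,\dot x,\ddot x,\dots)$ with the product topology; analytic functions on $\mathfrak X$ are those which locally are analytic functions of finitely many coordinates. Let $\frac{d}{dt}=\sum_{i}\sum_{j\ge 0} x_i^{(j+1)}\,\partial/\partial x_i^{(j)}$ be the Cartan field and $$\mathfrak X_0=\{\bar x\in\mathfrak X : (x,\dot x)\in\Omega,\ \tfrac{d^k}{dt^k}F(\bar x)=0 \text{ for all } k\ge 0\},$$ with the topology and the analytic functions induced by $\mathfrak X$. Let $\bar x_0\in\mathfrak X_0$ be such that $\operatorname{rank}\frac{\partial F}{\partial\dot x}(x_0,\dot x_0)=n-m$, and assume that the system is locally flat at $\bar x_0$: for some $\bar y_0\in\mathbb R^m_\infty=\mathbb R^m\times\mathbb R^m\times\cdots$ there are open neighborhoods $\mathcal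 X_0$ of $\bar x_0$ in $\mathfrak X_0$ and $\mathcal Y_0$ of $\bar y_0$ in $\mathbb R^m_\infty$ and mutually inverse analytic bijections $\Phi:\mathcal Y_0\to\mathcal X_0$, $\Psi:\mathcal X_0\to\mathcal Y_0$ with $\Phi(\bar y_0)=\bar x_0$ that exchange the Cartan fields of $\mathfrak X$ and $\mathbb R^m_\infty$. For $\bar x\in\mathfrak X_0$ let $\mathfrak K_{\bar x}$ be the total ring of fractions (the field of fractions, when there are no zero divisors) of the ring of germs at $\bar x$ of analytic functions on $\mathfrak X_0$, where a germ counts as zero if it and all its derivatives $\frac{d^k}{dt^k}$ vanish on $\mathfrak X_0$ near $\bar x$. For an open set $N$ of $\mathfrak X$ let $\mathfrak K_N$ be defined in the same way from the functions on $N\cap\mathfrak X_0$ that are restrictions of functions analytic near $N\cap\mathfrak X_0$. For $\mathfrak K=\mathfrak K_{\bar x}$ or $\mathfrak K_N$, let $\mathfrak K[\frac d{dt}]$ be the ring of polynomials in $\frac d{dt}$ with coefficients in $\mathfrak K$ and $\frac d{dt}\,a=a\,\frac d{dt}+\dot a$, and let $$P(F)=\frac{\partial F}{\partial x}+\frac{\partial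 F}{\partial\dot x}\frac{d}{dt},$$ an $(n-m)\times n$ matrix over $\mathfrak K[\frac d{dt}]$. The variational module at $\bar x$ is $[\xi]/[P(F)\xi]$: the free left $\mathfrak K_{\bar x}[\frac d{dt}]$-module on $\xi_1,\dots,\xi_n$ modulo the submodule generated by the rows of $P(F)\xi$. It is called controllable if it is free. The matrix $P(F)$ is called hyper-regular over $\mathfrak K[\frac d{dt}]$ if there are unimodular (that is, invertible over $\mathfrak K[\frac d{dt}]$) matrices $V,U$ with $V\,P(F)\,U=(I_{n-m},0_{n-m,m})$. Then there is an open neighborhood $N$ of $\bar x_0$ in $\mathfrak X$ such that, for every $\bar x\in N\cap\mathfrak X_0$, the variational module at $\bar x$ is free (controllable) and $P(F)$ is hyper-regular over $\mathfrak K_{\bar x}[\frac d{dt}]$. Moreover, $P(F)$ is hyper-regular over $\mathfrak K_N[\frac d{dt}]$, with one pair $V,U$ for the whole neighborhood. -/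

import Mathlib

open Filter Topology
open scoped Differential Polynomial

noncomputable section

/-! ### Differential operators with coefficients in a differential ring -/

/-- The ring `K[d/dt]` of polynomials in the indeterminate `d/dt` with coefficients in a commutative
differential ring `K`. The polynomial `∑ aᵢ Xⁱ` stands for the operator `∑ aᵢ (d/dt)ⁱ`, coefficients
on the left; the multiplication is the one determined by `(d/dt) a = a (d/dt) + a′`. -/
def DiffOp (K : Type*) [CommRing K] [Differential K] : Type _ := K[X]

namespace DiffOp

variable {K : Type*} [CommRing K] [Differential K]

instance : AddCommGroup (DiffOp K) := inferInstanceAs (AddCommGroup K[X])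

/-- The operator `∑ aᵢ (d/dt)ⁱ` with the coefficients of the polynomial `∑ aᵢ Xⁱ`. -/
def ofPoly : K[X] ≃+ DiffOp K := AddEquiv.refl _

/-- Left multiplication by `d/dt`: `∑ aᵢ (d/dt)ⁱ ↦ ∑ (aᵢ (d/dt)ⁱ⁺¹ + aᵢ′ (d/dt)ⁱ)`. -/
def leftD : Module.End ℤ K[X] :=
  LinearMap.mulLeft ℤ Polynomial.X + (Differential.mapCoeffs : Derivation ℤ K[X] K[X]).toLinearMap

/-- Left multiplication by `∑ aᵢ (d/dt)ⁱ`, namely `q ↦ ∑ aᵢ (d/dt)ⁱ q`. -/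
def leftMul (p : K[X]) : Module.End ℤ K[X] :=
  p.sum fun i a => LinearMap.mulLeft ℤ (Polynomial.C a) * leftD ^ i

instance : Mul (DiffOp K) := ⟨fun p q => ofPoly (leftMul (ofPoly.symm p) (ofPoly.symm q))⟩

instance : One (DiffOp K) := ⟨ofPoly 1⟩

theorem mul_def (p q : DiffOp K) :
    p * q = ofPoly (leftMul (ofPoly.symm p) (ofPoly.symm q)) := rfl

theorem leftD_apply (q : K[X]) : leftD q = Polynomial.X * q + Differential.mapCoeffs q := rfl

theorem leftMul_monomial (i : ℕ) (a : K) :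
    leftMul (Polynomial.monomial i a) = LinearMap.mulLeft ℤ (Polynomial.C a) * leftD ^ i := by
  refine Polynomial.sum_monomial_index _ _ ?_
  ext q
  simp

theorem leftMul_add (p q : K[X]) : leftMul (p + q) = leftMul p + leftMul q := by
  refine Polynomial.sum_add_index _ _ _ (fun i => ?_) (fun i a b => ?_)
  · ext q
    simp
  · refine LinearMap.ext fun q => ?_
    simp [add_mul]

theorem leftMul_zero : leftMul (0 : K[X]) = 0 := Polynomial.sum_zero_index _

theorem leftMul_C_mul (a : K) (q : K[X]) :
    leftMul (Polynomial.C a * q) = LinearMap.mulLeft ℤ (Polynomial.C a) * leftMul q := by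
  induction q using Polynomial.induction_on' with
  | add p q hp hq => rw [mul_add, leftMul_add, leftMul_add, hp, hq, mul_add]
  | monomial i b =>
    rw [Polynomial.C_mul_monomial, leftMul_monomial, leftMul_monomial, ← mul_assoc]
    congr 1
    refine LinearMap.ext fun q => ?_
    simp

theorem mapCoeffs_C_mul (a : K) (q : K[X]) :
    Differential.mapCoeffs (Polynomial.C a * q) =
      Polynomial.C a * Differential.mapCoeffs q + Polynomial.C (a′) * q := by
  ext i
  simp [Differential.coeff_mapCoeffs, mul_comm, add_comm]

theorem leftMul_leftD (q : K[X]) : leftMul (leftD q) = leftD * leftMul q := by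
  induction q using Polynomial.induction_on' with
  | add p q hp hq => rw [map_add, leftMul_add, leftMul_add, hp, hq, mul_add]
  | monomial i b =>
    have h : leftD (Polynomial.monomial i b) =
        Polynomial.monomial (i + 1) b + Polynomial.monomial i (b′) := by
      rw [leftD_apply, Polynomial.X_mul_monomial]
      congr 1
      ext j
      simp only [Differential.coeff_mapCoeffs, Polynomial.coeff_monomial]
      split_ifs <;> simp
    rw [h, leftMul_add, leftMul_monomial, leftMul_monomial, leftMul_monomial]
    refine LinearMap.ext fun q => ?_
    change Polynomial.C b * (leftD ^ (i + 1)) q + Polynomial.C (b′) * (leftD ^ i) q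
      = leftD (Polynomial.C b * (leftD ^ i) q)
    rw [leftD_apply, mapCoeffs_C_mul, pow_succ']
    change Polynomial.C b * leftD ((leftD ^ i) q) + _ = _
    rw [leftD_apply]
    ring

theorem leftMul_leftMul (p q : K[X]) : leftMul (leftMul p q) = leftMul p * leftMul q := by
  induction p using Polynomial.induction_on' with
  | add p r hp hr =>
    rw [leftMul_add, LinearMap.add_apply, leftMul_add, add_mul, hp, hr]
  | monomial i a =>
    rw [leftMul_monomial]
    change leftMul (Polynomial.C a * (leftD ^ i) q) = _
    rw [leftMul_C_mul, mul_assoc]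
    congr 1
    induction i with
    | zero => rfl
    | succ i ih =>
      rw [pow_succ', mul_assoc, ← ih]
      exact leftMul_leftD _

theorem leftMul_apply_one (p : K[X]) : leftMul p 1 = p := by
  have h (i : ℕ) : (leftD ^ i) (1 : K[X]) = Polynomial.X ^ i := by
    induction i with
    | zero => rfl
    | succ i ih =>
      rw [pow_succ', Module.End.mul_apply, ih, leftD_apply, pow_succ']
      simp
  induction p using Polynomial.induction_on' with
  | add p q hp hq => rw [leftMul_add, LinearMap.add_apply, hp, hq]
  | monomial i a =>
    rw [leftMul_monomial, Module.End.mul_apply, h]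
    simp [Polynomial.C_mul_X_pow_eq_monomial]

theorem leftMul_one : leftMul (1 : K[X]) = 1 := by
  rw [← Polynomial.monomial_zero_one, leftMul_monomial]
  refine LinearMap.ext fun q => ?_
  simp

instance : Ring (DiffOp K) :=
  { (inferInstance : AddCommGroup (DiffOp K)), (inferInstance : Mul (DiffOp K)),
    (inferInstance : One (DiffOp K)) with
    left_distrib := fun p q r => by simp only [mul_def, map_add]
    right_distrib := fun p q r => by
      simp only [mul_def, map_add, leftMul_add, LinearMap.add_apply]
    zero_mul := fun p => by
      simp only [mul_def, map_zero, leftMul_zero, LinearMap.zero_apply]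
    mul_zero := fun p => by simp only [mul_def, map_zero]
    mul_assoc := fun p q r => by
      simp only [mul_def, AddEquiv.symm_apply_apply, leftMul_leftMul, Module.End.mul_apply]
    one_mul := fun p => by
      change ofPoly (leftMul 1 (ofPoly.symm p)) = p
      rw [leftMul_one]
      rfl
    mul_one := fun p => leftMul_apply_one (K := K) p }

/-- The operator of order zero with coefficient `a`. -/
def C (a : K) : DiffOp K := ofPoly (Polynomial.C a)

/-- The operator `d/dt`. -/
def D : DiffOp K := ofPoly Polynomial.X

theorem D_mul_C (a : K) : (D : DiffOp K) * C a = C a * D + C (a′) := by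
  have h : (Polynomial.X : K[X]) = Polynomial.monomial 1 1 := Polynomial.monomial_one_one_eq_X.symm
  have h0 (b : K) : leftMul (Polynomial.C b) = LinearMap.mulLeft ℤ (Polynomial.C b) := by
    simpa [leftMul_one, Module.End.mul_eq_comp, Module.End.one_eq_id] using leftMul_C_mul b 1
  change leftMul Polynomial.X (Polynomial.C a) =
    leftMul (Polynomial.C a) Polynomial.X + Polynomial.C (a′)
  rw [h0, h, leftMul_monomial, pow_one, Module.End.mul_apply, leftD_apply, map_one, ← h]
  simp only [LinearMap.mulLeft_apply, one_mul, Differential.mapCoeffs_C]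
  rw [mul_comm]

end DiffOp

/-- Unimodular matrices `V`, `U` bring `M` to the form whose diagonal entries are `1` and whose other
entries are `0`: `(I, 0)` if `p < q`, `I` if `p = q`, and `(I, 0)ᵀ` if `p > q`. -/
def IsHyperRegular {R : Type*} [Ring R] {p q : ℕ} (M : Matrix (Fin p) (Fin q) R) : Prop :=
  ∃ (V : (Matrix (Fin p) (Fin p) R)ˣ) (U : (Matrix (Fin q) (Fin q) R)ˣ),
    (V : Matrix (Fin p) (Fin p) R) * M * (U : Matrix (Fin q) (Fin q) R) =
      Matrix.of fun (i : Fin p) (j : Fin q) => if (i : ℕ) = (j : ℕ) then (1 : R) else 0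

/-- The derivation of the total ring of fractions `K` of `A` that extends the derivation of `A`. It
is read off from the ring homomorphism `K → K[ε]`, `ε² = 0`, that extends `a ↦ a + a′ ε`. -/
def fractionDeriv (A K : Type*) [CommRing A] [Differential A] [CommRing K] [Algebra A K]
    [IsFractionRing A K] : {d : Derivation ℤ K K // ∀ a, d (algebraMap A K a) = algebraMap A K (a′)} :=
  let g : A →+* TrivSqZeroExt K K :=
    { toFun := fun a => TrivSqZeroExt.inl (algebraMap A K a) + TrivSqZeroExt.inr (algebraMap A K (a′))
      map_one' := by ext <;> simp
      map_zero' := by ext <;> simp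
      map_add' := fun a b => by ext <;> simp [Algebra.smul_def]
      map_mul' := fun a b => by
        refine TrivSqZeroExt.ext (by simp) ?_
        simp only [Derivation.leibniz, smul_eq_mul, map_add, map_mul, TrivSqZeroExt.snd_mul,
          TrivSqZeroExt.snd_add, TrivSqZeroExt.snd_inl, TrivSqZeroExt.snd_inr,
          TrivSqZeroExt.fst_add, TrivSqZeroExt.fst_inl, TrivSqZeroExt.fst_inr, add_zero, zero_add,
          MulOpposite.smul_eq_mul_unop, MulOpposite.unop_op]
        ring }
  have hg (y : nonZeroDivisors A) : IsUnit (g y) := by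
    rw [TrivSqZeroExt.isUnit_iff_isUnit_fst]
    simpa [g] using IsLocalization.map_units K y
  let G : K →+* TrivSqZeroExt K K := IsLocalization.lift hg
  have hG (a : A) : G (algebraMap A K a) = g a := IsLocalization.lift_eq hg a
  have hf (x : K) : (G x).fst = x := by
    have h : ((TrivSqZeroExt.fstHom K K K).toRingHom).comp G = RingHom.id K := by
      refine IsLocalization.ringHom_ext (nonZeroDivisors A) (RingHom.ext fun a => ?_)
      change (G (algebraMap A K a)).fst = algebraMap A K a
      rw [hG]
      simp [g]
    exact DFunLike.congr_fun h x
  ⟨Derivation.mk'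
    ((AddMonoidHom.mk' (fun x : K => (G x).snd) fun x y => by simp).toIntLinearMap) (by
      intro x y
      change (G (x * y)).snd = x • (G y).snd + y • (G x).snd
      rw [map_mul, TrivSqZeroExt.snd_mul, hf, hf]
      simp [mul_comm]), by
    intro a
    change (G (algebraMap A K a)).snd = _
    rw [hG]
    change (TrivSqZeroExt.inl _ + TrivSqZeroExt.inr _ : TrivSqZeroExt K K).snd = _
    rw [TrivSqZeroExt.snd_add, TrivSqZeroExt.snd_inl, TrivSqZeroExt.snd_inr, zero_add]⟩

instance fractionRingDifferential (A : Type*) [CommRing A] [Differential A] :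
    Differential (FractionRing A) :=
  ⟨(fractionDeriv A (FractionRing A)).1⟩

instance (A : Type*) [CommRing A] [Differential A] : DifferentialAlgebra A (FractionRing A) :=
  ⟨(fractionDeriv A (FractionRing A)).2⟩

/-! ### Jets of infinite order -/

/-- The jet space `ℝⁿ × ℝⁿ × ⋯` with the product topology: `z j i` is the coordinate `xᵢ⁽ʲ⁾`. -/
abbrev Jet (n : ℕ) : Type := ℕ → Fin n → ℝ

namespace Jet

variable {n : ℕ}

/-- The coordinates of order less than `r`. -/
def trunc (r : ℕ) (z : Jet n) : Fin r → Fin n → ℝ := fun j => z j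

/-- The trivial Cartan vector field `∑ xᵢ⁽ʲ⁺¹⁾ ∂/∂xᵢ⁽ʲ⁾`: its components at the point `z`. -/
def shift (z : Jet n) : Jet n := fun j => z (j + 1)

/-- Near `z`, the function `f` is a real-analytic function of finitely many coordinates. -/
def AnalyticNear (f : Jet n → ℝ) (z : Jet n) : Prop :=
  ∃ (r : ℕ) (g : (Fin r → Fin n → ℝ) → ℝ),
    AnalyticAt ℝ g (trunc r z) ∧ f =ᶠ[𝓝 z] fun w => g (trunc r w)

/-- The partial derivative `∂f/∂xᵢ⁽ʲ⁾`. -/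
def pderiv (f : Jet n → ℝ) (j : ℕ) (i : Fin n) (z : Jet n) : ℝ :=
  lineDeriv ℝ f z (Pi.single j (Pi.single i 1))

/-- The derivative `df/dt = ∑ xᵢ⁽ʲ⁺¹⁾ ∂f/∂xᵢ⁽ʲ⁾` of `f` along the Cartan field (for a function of
finitely many coordinates, this sum is the derivative of `f` in the direction `shift z`). -/
def cartan (f : Jet n → ℝ) (z : Jet n) : ℝ := lineDeriv ℝ f z (shift z)

/-- Restriction of truncated jets to lower order. -/
def resL (n : ℕ) {r s : ℕ} (h : r ≤ s) : (Fin s → Fin n → ℝ) →L[ℝ] (Fin r → Fin n → ℝ) :=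
  ContinuousLinearMap.pi fun j => ContinuousLinearMap.proj (Fin.castLE h j)

/-- The first-order truncated jets read in the coordinates of a truncated jet of one order more. -/
def shiftL (n r : ℕ) : (Fin (r + 1) → Fin n → ℝ) →L[ℝ] (Fin r → Fin n → ℝ) :=
  ContinuousLinearMap.pi fun j => ContinuousLinearMap.proj j.succ

theorem resL_trunc {r s : ℕ} (h : r ≤ s) (z : Jet n) : resL n h (trunc s z) = trunc r z := rfl

theorem shiftL_trunc (r : ℕ) (z : Jet n) : shiftL n r (trunc (r + 1) z) = trunc r (shift z) := rfl

theorem continuous_trunc (r : ℕ) : Continuous (trunc (n := n) r) := by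
  unfold trunc
  fun_prop

theorem AnalyticNear.congr {f g : Jet n → ℝ} {z : Jet n} (hf : AnalyticNear f z)
    (h : f =ᶠ[𝓝 z] g) : AnalyticNear g z := by
  obtain ⟨r, k, hk, hfk⟩ := hf
  exact ⟨r, k, hk, h.symm.trans hfk⟩

theorem AnalyticNear.eventually {f : Jet n → ℝ} {z : Jet n} (hf : AnalyticNear f z) :
    ∀ᶠ w in 𝓝 z, AnalyticNear f w := by
  obtain ⟨r, k, hk, hfk⟩ := hf
  filter_upwards [(continuous_trunc r).continuousAt.eventually hk.eventually_analyticAt,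
    hfk.eventually_nhds] with w h1 h2
  exact ⟨r, k, h1, h2⟩

theorem analyticNear_const (c : ℝ) (z : Jet n) : AnalyticNear (fun _ => c) z :=
  ⟨0, fun _ => c, analyticAt_const, Eventually.of_forall fun _ => rfl⟩

theorem AnalyticNear.exists_pair {f g : Jet n → ℝ} {z : Jet n} (hf : AnalyticNear f z)
    (hg : AnalyticNear g z) : ∃ (r : ℕ) (k l : (Fin r → Fin n → ℝ) → ℝ),
      AnalyticAt ℝ k (trunc r z) ∧ AnalyticAt ℝ l (trunc r z) ∧
      (f =ᶠ[𝓝 z] fun w => k (trunc r w)) ∧ (g =ᶠ[𝓝 z] fun w => l (trunc r w)) := by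
  obtain ⟨r, k, hk, hfk⟩ := hf
  obtain ⟨s, l, hl, hgl⟩ := hg
  refine ⟨max r s, k ∘ resL n (le_max_left r s), l ∘ resL n (le_max_right r s),
    AnalyticAt.comp ?_ ((resL n _).analyticAt _), AnalyticAt.comp ?_ ((resL n _).analyticAt _),
    hfk, hgl⟩
  · rwa [resL_trunc]
  · rwa [resL_trunc]

theorem AnalyticNear.add {f g : Jet n → ℝ} {z : Jet n} (hf : AnalyticNear f z)
    (hg : AnalyticNear g z) : AnalyticNear (f + g) z := by
  obtain ⟨r, k, l, hk, hl, hfk, hgl⟩ := hf.exists_pair hg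
  exact ⟨r, k + l, hk.add hl, hfk.add hgl⟩

theorem AnalyticNear.mul {f g : Jet n → ℝ} {z : Jet n} (hf : AnalyticNear f z)
    (hg : AnalyticNear g z) : AnalyticNear (f * g) z := by
  obtain ⟨r, k, l, hk, hl, hfk, hgl⟩ := hf.exists_pair hg
  exact ⟨r, k * l, hk.mul hl, hfk.mul hgl⟩

theorem AnalyticNear.neg {f : Jet n → ℝ} {z : Jet n} (hf : AnalyticNear f z) :
    AnalyticNear (-f) z := by
  obtain ⟨r, k, hk, hfk⟩ := hf
  exact ⟨r, -k, hk.neg, hfk.neg⟩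

theorem hasLineDerivAt_of_eventuallyEq {f : Jet n → ℝ} {z : Jet n} {r : ℕ}
    {k : (Fin r → Fin n → ℝ) → ℝ} (hk : AnalyticAt ℝ k (trunc r z))
    (h : f =ᶠ[𝓝 z] fun w => k (trunc r w)) (v : Jet n) :
    HasLineDerivAt ℝ f (fderiv ℝ k (trunc r z) (trunc r v)) z v := by
  have hline : HasLineDerivAt ℝ k (fderiv ℝ k (trunc r z) (trunc r v)) (trunc r z) (trunc r v) :=
    hk.differentiableAt.hasFDerivAt.hasLineDerivAt _
  have hc : Tendsto (fun t : ℝ => z + t • v) (𝓝 0) (𝓝 z) := by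
    have : Continuous fun t : ℝ => z + t • v := by fun_prop
    simpa using this.tendsto 0
  exact HasDerivAt.congr_of_eventuallyEq hline (hc.eventually h)

theorem AnalyticNear.hasLineDerivAt {f : Jet n → ℝ} {z : Jet n} (hf : AnalyticNear f z)
    (v : Jet n) : HasLineDerivAt ℝ f (lineDeriv ℝ f z v) z v := by
  obtain ⟨r, k, hk, hfk⟩ := hf
  exact (hasLineDerivAt_of_eventuallyEq hk hfk v).lineDifferentiableAt.hasLineDerivAt

theorem AnalyticNear.pderiv {f : Jet n → ℝ} {z : Jet n} (hf : AnalyticNear f z) (j : ℕ)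
    (i : Fin n) : AnalyticNear (pderiv f j i) z := by
  obtain ⟨r, k, hk, hfk⟩ := hf
  refine ⟨r, fun p => fderiv ℝ k p (trunc r (Pi.single j (Pi.single i 1))),
    
    ((ContinuousLinearMap.id ℝ ((Fin r → Fin n → ℝ) →L[ℝ] ℝ)).analyticAt_bilinear
      (_, _)).comp₂ hk.fderiv analyticAt_const, ?_⟩
  filter_upwards [(continuous_trunc r).continuousAt.eventually hk.eventually_analyticAt,
    hfk.eventually_nhds] with w h1 h2
  exact (hasLineDerivAt_of_eventuallyEq h1 h2 _).lineDeriv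

theorem AnalyticNear.cartan {f : Jet n → ℝ} {z : Jet n} (hf : AnalyticNear f z) :
    AnalyticNear (cartan f) z := by
  obtain ⟨r, k, hk, hfk⟩ := hf
  refine ⟨r + 1, fun p => fderiv ℝ k (resL n r.le_succ p) (shiftL n r p), ?_, ?_⟩
  · refine ((ContinuousLinearMap.id ℝ ((Fin r → Fin n → ℝ) →L[ℝ] ℝ)).analyticAt_bilinear
      (_, _)).comp₂ (AnalyticAt.fun_comp ?_ ((resL n _).analyticAt _)) ((shiftL n r).analyticAt _)
    rw [resL_trunc]
    exact hk.fderiv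
  · filter_upwards [(continuous_trunc r).continuousAt.eventually hk.eventually_analyticAt,
      hfk.eventually_nhds] with w h1 h2
    exact (hasLineDerivAt_of_eventuallyEq h1 h2 _).lineDeriv

theorem cartan_congr {f g : Jet n → ℝ} {z : Jet n} (h : f =ᶠ[𝓝 z] g) :
    cartan f =ᶠ[𝓝 z] cartan g := by
  filter_upwards [h.eventually_nhds] with w hw
  have hc : Tendsto (fun t : ℝ => w + t • shift w) (𝓝 0) (𝓝 w) := by
    have : Continuous fun t : ℝ => w + t • shift w := by fun_prop
    simpa using this.tendsto 0
  exact Filter.EventuallyEq.deriv_eq (hc.eventually hw)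

theorem cartan_iterate_congr {f g : Jet n → ℝ} {z : Jet n} (h : f =ᶠ[𝓝 z] g) (k : ℕ) :
    cartan^[k] f =ᶠ[𝓝 z] cartan^[k] g := by
  induction k generalizing f g with
  | zero => exact h
  | succ k ih => exact ih (cartan_congr h)

theorem cartan_const (c : ℝ) : cartan (fun _ : Jet n => c) = 0 := by
  funext z
  simp [cartan, lineDeriv]

theorem cartan_add {f g : Jet n → ℝ} {z : Jet n} (hf : AnalyticNear f z)
    (hg : AnalyticNear g z) : cartan (f + g) =ᶠ[𝓝 z] cartan f + cartan g := by
  filter_upwards [hf.eventually, hg.eventually] with w h1 h2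
  exact (HasDerivAt.add (h1.hasLineDerivAt (shift w)) (h2.hasLineDerivAt (shift w))).deriv

theorem cartan_mul {f g : Jet n → ℝ} {z : Jet n} (hf : AnalyticNear f z)
    (hg : AnalyticNear g z) : cartan (f * g) =ᶠ[𝓝 z] cartan f * g + f * cartan g := by
  filter_upwards [hf.eventually, hg.eventually] with w h1 h2
  have h := (HasDerivAt.mul (h1.hasLineDerivAt (shift w)) (h2.hasLineDerivAt (shift w))).deriv
  simp only [zero_smul, add_zero] at h
  exact h

theorem AnalyticNear.cartan_iterate {f : Jet n → ℝ} {z : Jet n} (hf : AnalyticNear f z) (k : ℕ) :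
    AnalyticNear (Jet.cartan^[k] f) z := by
  induction k generalizing f with
  | zero => exact hf
  | succ k ih => exact ih hf.cartan

theorem cartan_iterate_add {f g : Jet n → ℝ} {z : Jet n} (hf : AnalyticNear f z)
    (hg : AnalyticNear g z) (k : ℕ) :
    cartan^[k] (f + g) =ᶠ[𝓝 z] cartan^[k] f + cartan^[k] g := by
  induction k generalizing f g with
  | zero => rfl
  | succ k ih => exact (cartan_iterate_congr (cartan_add hf hg) k).trans (ih hf.cartan hg.cartan)

end Jet

/-! ### Analytic and meromorphic functions near a set of jets -/

namespace Jet

variable {n : ℕ} (L : Filter (Jet n))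

/-- The functions that are real analytic at the points of the filter `L`. -/
def analyticSubring : Subring (Jet n → ℝ) where
  carrier := {f | ∀ᶠ z in L, AnalyticNear f z}
  mul_mem' hf hg := by
    filter_upwards [hf, hg] with z h1 h2 using h1.mul h2
  one_mem' := Eventually.of_forall fun z => analyticNear_const 1 z
  add_mem' hf hg := by
    filter_upwards [hf, hg] with z h1 h2 using h1.add h2
  zero_mem' := Eventually.of_forall fun z => analyticNear_const 0 z
  neg_mem' hf := by
    filter_upwards [hf] with z h1 using h1.neg

variable {L}

theorem cartan_mem (f : analyticSubring L) : cartan (f : Jet n → ℝ) ∈ analyticSubring L := by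
  have hf : ∀ᶠ z in L, AnalyticNear (f : Jet n → ℝ) z := f.2
  show ∀ᶠ z in L, AnalyticNear (cartan (f : Jet n → ℝ)) z
  filter_upwards [hf] with z hz using hz.cartan

theorem cartan_iterate_eq_zero {f : Jet n → ℝ} {z : Jet n} (h : f =ᶠ[𝓝 z] 0) (k : ℕ) :
    cartan^[k] f z = 0 := by
  have h0 : cartan^[k] (0 : Jet n → ℝ) = 0 := by
    induction k with
    | zero => rfl
    | succ k ih =>
      rw [Function.iterate_succ_apply]
      exact (congrArg _ (cartan_const 0)).trans ih
  rw [(cartan_iterate_congr h k).eq_of_nhds, h0]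
  rfl

theorem cartan_iterate_mul_eq_zero (k : ℕ) (g f : analyticSubring L)
    (hf : ∀ k, ∀ᶠ z in L, cartan^[k] (f : Jet n → ℝ) z = 0) :
    ∀ᶠ z in L, cartan^[k] ((g : Jet n → ℝ) * (f : Jet n → ℝ)) z = 0 := by
  induction k generalizing g f with
  | zero =>
    filter_upwards [hf 0] with z hz
    simp only [Function.iterate_zero, id_eq] at hz
    simp [hz]
  | succ k ih =>
    have hg1 : ∀ᶠ z in L, AnalyticNear (g : Jet n → ℝ) z := g.2
    have hf1 : ∀ᶠ z in L, AnalyticNear (f : Jet n → ℝ) z := f.2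
    filter_upwards [ih ⟨_, cartan_mem g⟩ f hf, ih g ⟨_, cartan_mem f⟩ fun j => hf (j + 1), hg1, hf1]
      with z h1 h2 hgz hfz
    rw [Function.iterate_succ_apply, (cartan_iterate_congr (cartan_mul hgz hfz) k).eq_of_nhds,
      (cartan_iterate_add (hgz.cartan.mul hfz) (hgz.mul hfz.cartan) k).eq_of_nhds, Pi.add_apply,
      h1, h2, add_zero]

variable (L)

/-- The functions that vanish along `L` together with all their derivatives along the Cartan field.
When `L` is carried by a set to which the Cartan field is tangent, the condition on the derivatives
is automatic, so that these are the functions whose restriction to this set is zero. -/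
def vanishingIdeal : Ideal (analyticSubring L) where
  carrier := {f | ∀ k, ∀ᶠ z in L, cartan^[k] (f : Jet n → ℝ) z = 0}
  add_mem' {f g} hf hg k := by
    have hf1 : ∀ᶠ z in L, AnalyticNear (f : Jet n → ℝ) z := f.2
    have hg1 : ∀ᶠ z in L, AnalyticNear (g : Jet n → ℝ) z := g.2
    filter_upwards [hf k, hg k, hf1, hg1] with z h1 h2 hfz hgz
    have h := (cartan_iterate_add hfz hgz k).eq_of_nhds
    rw [Pi.add_apply, h1, h2, add_zero] at h
    exact h
  zero_mem' k := Eventually.of_forall fun z => cartan_iterate_eq_zero (EventuallyEq.refl _ _) k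
  smul_mem' g f hf k := cartan_iterate_mul_eq_zero k g f hf

/-- The ring of real-analytic functions along `L`, restricted to `L`. -/
def FnRing : Type := analyticSubring L ⧸ vanishingIdeal L

instance : CommRing (FnRing L) := inferInstanceAs (CommRing (analyticSubring L ⧸ vanishingIdeal L))

/-- The restriction to `L` of a function that is analytic along `L`. -/
def FnRing.mk : analyticSubring L →+* FnRing L := Ideal.Quotient.mk (vanishingIdeal L)

variable {L}

theorem FnRing.mk_eq_zero {f : analyticSubring L} : FnRing.mk L f = 0 ↔ f ∈ vanishingIdeal L :=
  Ideal.Quotient.eq_zero_iff_mem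

theorem FnRing.mk_surjective : Function.Surjective (FnRing.mk L) := Ideal.Quotient.mk_surjective

theorem FnRing.mk_eq_mk {f g : analyticSubring L}
    (h : ∀ᶠ z in L, (f : Jet n → ℝ) =ᶠ[𝓝 z] (g : Jet n → ℝ)) : FnRing.mk L f = FnRing.mk L g := by
  rw [← sub_eq_zero, ← map_sub, FnRing.mk_eq_zero]
  intro k
  filter_upwards [h] with z hz
  refine cartan_iterate_eq_zero ?_ k
  filter_upwards [hz] with w hw
  simp [hw]

variable (L)

/-- The map `f ↦ df/dt` on representatives. -/
def FnRing.preDeriv : analyticSubring L →+ FnRing L :=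
  AddMonoidHom.mk' (fun f => FnRing.mk L ⟨cartan (f : Jet n → ℝ), cartan_mem f⟩) fun f g => by
    have hf : ∀ᶠ z in L, AnalyticNear (f : Jet n → ℝ) z := f.2
    have hg : ∀ᶠ z in L, AnalyticNear (g : Jet n → ℝ) z := g.2
    rw [← map_add]
    refine FnRing.mk_eq_mk ?_
    filter_upwards [hf, hg] with z h1 h2 using cartan_add h1 h2

/-- The derivation `d/dt` along the Cartan field. -/
instance : Differential (FnRing L) where
  deriv := Derivation.mk'
    ((QuotientAddGroup.lift (vanishingIdeal L).toAddSubgroup (FnRing.preDeriv L) (by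
      intro f hf
      exact FnRing.mk_eq_zero.2 fun k => hf (k + 1)) : FnRing L →+ FnRing L).toIntLinearMap) (by
    intro a b
    obtain ⟨f, rfl⟩ := FnRing.mk_surjective a
    obtain ⟨g, rfl⟩ := FnRing.mk_surjective b
    change FnRing.mk L ⟨cartan ((f * g : analyticSubring L) : Jet n → ℝ), _⟩ =
      FnRing.mk L f * FnRing.mk L ⟨cartan (g : Jet n → ℝ), _⟩ +
      FnRing.mk L g * FnRing.mk L ⟨cartan (f : Jet n → ℝ), _⟩
    have hf : ∀ᶠ z in L, AnalyticNear (f : Jet n → ℝ) z := f.2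
    have hg : ∀ᶠ z in L, AnalyticNear (g : Jet n → ℝ) z := g.2
    rw [← map_mul, ← map_mul, ← map_add]
    refine FnRing.mk_eq_mk ?_
    filter_upwards [hf, hg] with z h1 h2
    refine (cartan_mul h1 h2).trans (Eventually.of_forall fun w => ?_)
    simp only [Pi.add_apply, Pi.mul_apply, Subring.coe_add, Subring.coe_mul]
    ring)

theorem FnRing.deriv_mk (f : analyticSubring L) :
    (FnRing.mk L f)′ = FnRing.mk L ⟨cartan (f : Jet n → ℝ), cartan_mem f⟩ := rfl

/-- Meromorphic functions along `L`: the total ring of fractions of the ring of analytic functions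
(the field of fractions when the latter is an integral domain), with the derivation `d/dt`. -/
abbrev Mer : Type := FractionRing (FnRing L)

end Jet

/-! ### Implicit systems -/

/-- An implicit system `F(x, ẋ) = 0` of `q` equations in `n` unknowns `x₁, …, xₙ`, where `F` is real
analytic on an open set `dom` of pairs `(x, ẋ)` (for instance all of `TX = X × ℝⁿ`, `X` open). -/
structure ImplicitSystem (n q : ℕ) where
  dom : Set ((Fin n → ℝ) × (Fin n → ℝ))
  isOpen_dom : IsOpen dom
  F : (Fin n → ℝ) × (Fin n → ℝ) → Fin q → ℝ
  analytic : AnalyticOnNhd ℝ F dom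

/-- The trivial system: no equation on the coordinates of `ℝᵐ × ℝᵐ × ⋯`. -/
def trivialSystem (m : ℕ) : ImplicitSystem m 0 where
  dom := Set.univ
  isOpen_dom := isOpen_univ
  F := 0
  analytic := fun _ _ => analyticAt_const

namespace ImplicitSystem

variable {n q : ℕ} (S : ImplicitSystem n q)

/-- The function `Fᵢ(x, ẋ)` on the jet space. -/
def eqn (i : Fin q) (z : Jet n) : ℝ := S.F (z 0, z 1) i

/-- The set of jets that satisfy the equations and all their derivatives:
`(d/dt)ᵏ Fᵢ = 0` for all `k ≥ 0`. -/
def locus : Set (Jet n) :=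
  {z | (z 0, z 1) ∈ S.dom ∧ ∀ (k : ℕ) (i : Fin q), Jet.cartan^[k] (S.eqn i) z = 0}

/-- `rank ∂F/∂ẋ = q` at the point `(x, ẋ)` of the jet `z`. -/
def IsRegularAt (z : Jet n) : Prop :=
  (Matrix.of fun (i : Fin q) (j : Fin n) => Jet.pderiv (S.eqn i) 1 j z).rank = q

/-- The map `Φ`, defined on the open subset `U ∩ locus` of the locus of `S`, is analytic and maps the
Cartan field to the Cartan field: near every point, the component `Φᵢ⁽ʲ⁾` is the restriction of an
analytic function `f` of finitely many coordinates, and `Φᵢ⁽ʲ⁺¹⁾` is the restriction of `df/dt`. -/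
def IsLieBacklundMap {p : ℕ} (U : Set (Jet n)) (Φ : Jet n → Jet p) : Prop :=
  ∀ z ∈ U ∩ S.locus, ∀ (j : ℕ) (i : Fin p), ∃ f : Jet n → ℝ, Jet.AnalyticNear f z ∧
    (∀ᶠ w in 𝓝[S.locus] z, Φ w j i = f w) ∧
    (∀ᶠ w in 𝓝[S.locus] z, Φ w (j + 1) i = Jet.cartan f w)

/-- Lie–Bäcklund equivalence at `(x, y)`: there are mutually inverse analytic bijections `Ψ`, `Φ`
between open neighborhoods of `x` and of `y` in the two loci that exchange `x` and `y` and the two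
Cartan fields. -/
def LieBacklundEquivAt {p r : ℕ} (T : ImplicitSystem p r) (x : Jet n) (y : Jet p) : Prop :=
  x ∈ S.locus ∧ y ∈ T.locus ∧
  ∃ (U : Set (Jet n)) (V : Set (Jet p)) (Φ : Jet p → Jet n) (Ψ : Jet n → Jet p),
    IsOpen U ∧ x ∈ U ∧ IsOpen V ∧ y ∈ V ∧
    Set.MapsTo Φ (V ∩ T.locus) (U ∩ S.locus) ∧ Set.MapsTo Ψ (U ∩ S.locus) (V ∩ T.locus) ∧
    Set.LeftInvOn Ψ Φ (V ∩ T.locus) ∧ Set.LeftInvOn Φ Ψ (U ∩ S.locus) ∧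
    Φ y = x ∧ Ψ x = y ∧
    T.IsLieBacklundMap V Φ ∧ S.IsLieBacklundMap U Ψ

/-- Local flatness at `x`: Lie–Bäcklund equivalence, at `x` and some `y`, to the trivial system of
dimension `m`. -/
def IsLocallyFlatAt (m : ℕ) (x : Jet n) : Prop :=
  ∃ y : Jet m, S.LieBacklundEquivAt (trivialSystem m) x y

/-! ### The variational module -/

theorem eqn_mem {z : Jet n} (hz : (z 0, z 1) ∈ S.dom) (i : Fin q) :
    Jet.AnalyticNear (S.eqn i) z := by
  let c : (Fin 2 → Fin n → ℝ) →L[ℝ] (Fin n → ℝ) × (Fin n → ℝ) :=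
    (ContinuousLinearMap.proj 0).prod (ContinuousLinearMap.proj 1)
  refine ⟨2, fun p => S.F (c p) i, ?_, Eventually.of_forall fun w => rfl⟩
  have h1 : AnalyticAt ℝ S.F (c (Jet.trunc 2 z)) := S.analytic _ hz
  have h2 : AnalyticAt ℝ (fun p => S.F (c p)) (Jet.trunc 2 z) :=
    AnalyticAt.fun_comp h1 (c.analyticAt _)
  exact ((ContinuousLinearMap.proj (R := ℝ) (φ := fun _ : Fin q => ℝ) i).analyticAt _).fun_comp h2

variable (l : Filter (Jet n))

/-- The trace on the locus of a filter of jets: for `l = 𝓝 x` one obtains germs at `x` of functions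
on the locus, and for `l = 𝓟 N` functions on `N ∩ locus`. -/
def traceFilter : Filter (Jet n) := l ⊓ 𝓟 S.locus

/-- The differential ring of meromorphic functions on the locus, along `l`. -/
abbrev Coeff : Type := Jet.Mer (S.traceFilter l)

/-- The function `∂Fᵢ/∂xₖ⁽ʲ⁾`, restricted to the locus. -/
def partialF (j : ℕ) (i : Fin q) (k : Fin n) : S.Coeff l :=
  algebraMap (Jet.FnRing (S.traceFilter l)) _
    (Jet.FnRing.mk _ ⟨Jet.pderiv (S.eqn i) j k, by
      show ∀ᶠ z in S.traceFilter l, Jet.AnalyticNear _ z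
      filter_upwards [mem_inf_of_right (mem_principal_self S.locus)] with z hz
      exact (S.eqn_mem hz.1 i).pderiv j k⟩)

/-- The polynomial matrix `P(F) = ∂F/∂x + ∂F/∂ẋ d/dt`. -/
def polyMatrix : Matrix (Fin q) (Fin n) (DiffOp (S.Coeff l)) :=
  Matrix.of fun i k =>
    DiffOp.C (S.partialF l 0 i k) + DiffOp.C (S.partialF l 1 i k) * DiffOp.D

/-- The variational module `[ξ]/[P(F)ξ]`: the free left module on `ξ₁, …, ξₙ` modulo the submodule
generated by the rows of `P(F) ξ`. -/
abbrev VariationalModule : Type :=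
  (Fin n → DiffOp (S.Coeff l)) ⧸
    Submodule.span (DiffOp (S.Coeff l)) (Set.range fun i => S.polyMatrix l i)

/-- The variational module along `l` is controllable if and only if it is free. -/
def IsControllable : Prop := Module.Free (DiffOp (S.Coeff l)) (S.VariationalModule l)

end ImplicitSystem

end

/-! Flatness provides finitely many analytic functions, `f` of the jets of `x` and `φ` of the jets
of `y ∈ ℝᵐ`, whose prolongations are mutually inverse between the locus and the jets of `ℝᵐ`. Write
`P = P(F)`, let `T` be the matrix of operators that is the differential of `f`, and `Q` that of `φ`,
taken along `prolong f`. By the chain rule (`IsDiffAlong.comp_prolong`), composition with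
prolongations becomes multiplication of operator matrices. The identities `f ∘ prolong φ = y` and `F
∘ prolong φ = 0` hold on open sets of jets of `y`, hence `T Q = 1` and `P Q = 0`.

The identity `φ ∘ prolong f = x` holds on the locus only, so `1 - Q T` need not vanish. Its rows
kill the velocities of curves in the locus, and the point is that they are left multiples of the
rows of `P`. This is where the rank condition enters. Let `B` be a constant matrix with `(∂F/∂ẋ) B`
invertible. Division by `P` leaves a remainder `w` such that `w B` has order zero
(`exists_vecMul_sub_order_zero`). On the other hand, the implicit function theorem, followed by a
recursive solution of the differentiated equations, yields curves in the locus whose velocity is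
arbitrary modulo the range of `B` in the orders `≥ 1` (`exists_curve_mem_locus`). A remainder that
kills all these velocities is zero, so `1 - Q T = W P` for some `W`.

Since `P` can be cancelled on the right (`eq_zero_of_vecMul_eq_zero`), it follows that `P W = 1` and
`T W = 0`. Thus the square matrix with blocks `P` over `T` is inverse to `(W, Q)`. This gives
hyper-regularity with `V = 1` and `U = (W, Q)`, and identifies the variational module with the free
module on `m` generators.

All identities are established over the ring of analytic functions on `N ∩ locus` and then mapped to
every ring of meromorphic functions in question. In that ring, functions that agree on the locus are
equal because the Cartan field is tangent to the locus, which is itself a consequence of flatness.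
-/

noncomputable section

/-! ### Coefficients of differential operators and change of coefficient ring. -/

namespace DiffOp

variable {K : Type*} [CommRing K] [Differential K]

/-- The coefficient of `(d/dt)ʲ`. -/
def coeff (j : ℕ) : DiffOp K →+ K :=
  (Polynomial.lcoeff K j).toAddMonoidHom.comp (ofPoly (K := K)).symm.toAddMonoidHom

theorem coeff_ofPoly (j : ℕ) (p : K[X]) : coeff j (ofPoly p) = p.coeff j := rfl

theorem ext_coeff {x y : DiffOp K} (h : ∀ j, coeff j x = coeff j y) : x = y :=
  Polynomial.ext (p := (ofPoly (K := K)).symm x) (q := (ofPoly (K := K)).symm y) h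

theorem exists_forall_ge_coeff_eq_zero (x : DiffOp K) : ∃ d, ∀ j ≥ d, coeff j x = 0 :=
  ⟨((ofPoly (K := K)).symm x).natDegree + 1, fun _ hj =>
    Polynomial.coeff_eq_zero_of_natDegree_lt hj⟩

theorem C_mul_eq (a : K) (p : K[X]) : C a * ofPoly p = ofPoly (Polynomial.C a * p) := by
  change leftMul (Polynomial.C a) p = Polynomial.C a * p
  simpa [leftMul_one] using congrArg (fun f => f p) (leftMul_C_mul a 1)

theorem D_mul_eq (p : K[X]) :
    D * ofPoly p = ofPoly (Polynomial.X * p + Differential.mapCoeffs p) := by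
  change leftMul Polynomial.X p = _
  rw [← Polynomial.monomial_one_one_eq_X, leftMul_monomial, pow_one, Module.End.mul_apply,
    leftD_apply, map_one, Polynomial.monomial_one_one_eq_X]
  simp only [LinearMap.mulLeft_apply, one_mul]
  rfl

theorem coeff_C_mul (a : K) (x : DiffOp K) (j : ℕ) : coeff j (C a * x) = a * coeff j x := by
  obtain ⟨p, rfl⟩ := (ofPoly (K := K)).surjective x
  rw [C_mul_eq, coeff_ofPoly, coeff_ofPoly, Polynomial.coeff_C_mul]

theorem coeff_zero_D_mul (x : DiffOp K) : coeff 0 (D * x) = (coeff 0 x)′ := by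
  obtain ⟨p, rfl⟩ := (ofPoly (K := K)).surjective x
  rw [D_mul_eq, coeff_ofPoly, coeff_ofPoly]
  simp [Differential.coeff_mapCoeffs]

theorem coeff_succ_D_mul (x : DiffOp K) (j : ℕ) :
    coeff (j + 1) (D * x) = coeff j x + (coeff (j + 1) x)′ := by
  obtain ⟨p, rfl⟩ := (ofPoly (K := K)).surjective x
  rw [D_mul_eq]
  simp only [coeff_ofPoly]
  simp [Differential.coeff_mapCoeffs]

theorem coeff_C (a : K) (j : ℕ) : coeff j (C a) = if j = 0 then a else 0 := by
  rw [C, coeff_ofPoly, Polynomial.coeff_C]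

theorem C_zero : C (0 : K) = 0 := by
  refine ext_coeff fun j => ?_
  simp [coeff_C]

theorem C_one : C (1 : K) = 1 := rfl

theorem C_add (a b : K) : C (a + b) = C a + C b := by
  refine ext_coeff fun j => ?_
  rw [map_add]
  simp only [coeff_C]
  split_ifs <;> simp

theorem C_mul (a b : K) : C (a * b) = C a * C b := by
  refine ext_coeff fun j => ?_
  rw [coeff_C_mul]
  simp only [coeff_C]
  split_ifs <;> simp

/-- The inclusion of the operators of order zero. -/
def CHom : K →+* DiffOp K where
  toFun := C
  map_one' := C_one
  map_mul' := C_mul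
  map_zero' := C_zero
  map_add' := C_add

theorem CHom_apply (a : K) : CHom a = C a := rfl

theorem D_pow_eq (i : ℕ) : (D : DiffOp K) ^ i = ofPoly (Polynomial.X ^ i) := by
  induction i with
  | zero => rfl
  | succ i ih =>
    rw [pow_succ', ih, D_mul_eq, pow_succ']
    congr 1
    ext j
    simp only [Polynomial.coeff_add, Differential.coeff_mapCoeffs, Polynomial.coeff_X_pow]
    split_ifs <;> simp

theorem coeff_C_mul_D_pow (a : K) (i j : ℕ) :
    coeff j (C a * D ^ i) = if j = i then a else 0 := by
  rw [coeff_C_mul, D_pow_eq, coeff_ofPoly, Polynomial.coeff_X_pow]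
  simp

/-- Tailored to the multiplication, which is explicit for left factors `C a` and `D` only:
multiplicative statements are proved by peeling such factors off the left. -/
theorem induction_on {motive : DiffOp K → Prop} (x : DiffOp K)
    (add : ∀ x y, motive x → motive y → motive (x + y))
    (C_mul : ∀ a x, motive x → motive (C a * x))
    (D_mul : ∀ x, motive x → motive (D * x)) (one : motive 1) : motive x := by
  have hD (i : ℕ) : motive (D ^ i) := by
    induction i with
    | zero => simpa using one
    | succ i ih => rw [pow_succ']; exact D_mul _ ih
  have h : ∀ p : K[X], motive (ofPoly p) := by
    intro p
    induction p using Polynomial.induction_on' with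
    | add p q hp hq => rw [map_add]; exact add _ _ hp hq
    | monomial i a =>
      rw [← Polynomial.C_mul_X_pow_eq_monomial, ← C_mul_eq, ← D_pow_eq]
      exact C_mul _ _ (hD i)
  exact h x

/-- A constant commutes with `d/dt`, hence is central. -/
theorem coeff_mul_C_of_deriv_eq_zero (x : DiffOp K) {b : K} (hb : b′ = 0) (j : ℕ) :
    coeff j (x * C b) = coeff j x * b := by
  suffices h : x * C b = C b * x by rw [h, coeff_C_mul, mul_comm]
  induction x using induction_on with
  | add x y hx hy => rw [add_mul, mul_add, hx, hy]
  | C_mul a x hx => rw [mul_assoc, hx, ← mul_assoc, ← mul_assoc, ← C_mul, ← C_mul, mul_comm a b]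
  | D_mul x hx => rw [mul_assoc, hx, ← mul_assoc, D_mul_C, hb, C_zero, add_zero, mul_assoc]
  | one => rw [one_mul, mul_one]

/-- Moving `b` to the left through `(d/dt)ⁱ` produces only terms of order at most `i`, so right
multiplication by a function does not raise the order. -/
theorem coeff_mul_C_eq_zero (x : DiffOp K) (b : K) (d : ℕ) (hx : ∀ j ≥ d, coeff j x = 0) :
    ∀ j ≥ d, coeff j (x * C b) = 0 := by
  have hD (i : ℕ) : ∀ j > i, coeff j ((D : DiffOp K) ^ i * C b) = 0 := by
    induction i with
    | zero => intro j hj; rw [pow_zero, one_mul, coeff_C, if_neg (by omega)]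
    | succ i ih =>
      intro j hj
      obtain ⟨j, rfl⟩ : ∃ k, j = k + 1 := ⟨j - 1, by omega⟩
      rw [pow_succ', mul_assoc, coeff_succ_D_mul, ih j (by omega), ih (j + 1) (by omega)]
      simp
  obtain ⟨p, rfl⟩ := (ofPoly (K := K)).surjective x
  intro j hj
  have hp : (ofPoly p : DiffOp K) = ∑ i ∈ p.support, C (p.coeff i) * D ^ i := by
    conv_lhs => rw [p.as_sum_support_C_mul_X_pow]
    rw [map_sum]
    simp_rw [D_pow_eq, C_mul_eq]
  rw [hp, Finset.sum_mul, map_sum]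
  refine Finset.sum_eq_zero fun i hi => ?_
  have hid : i < d := by
    by_contra h
    exact (Polynomial.mem_support_iff.1 hi) (hx i (by omega))
  rw [mul_assoc, coeff_C_mul, hD i j (by omega), mul_zero]

/-- Coefficients stand on the left, so right multiplication by `d/dt` differentiates nothing and
only shifts. -/
theorem coeff_succ_mul_D (x : DiffOp K) (j : ℕ) : coeff (j + 1) (x * D) = coeff j x := by
  induction x using induction_on generalizing j with
  | add x y hx hy => rw [add_mul, map_add, map_add, hx, hy]
  | C_mul a x hx => rw [mul_assoc, coeff_C_mul, coeff_C_mul, hx]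
  | D_mul x hx =>
    rw [mul_assoc, coeff_succ_D_mul, hx]
    cases j with
    | zero =>
      rw [coeff_zero_D_mul]
      have h0 : coeff 0 (x * D) = 0 := by
        clear hx
        induction x using induction_on with
        | add x y hx hy => rw [add_mul, map_add, hx, hy, add_zero]
        | C_mul a x hx => rw [mul_assoc, coeff_C_mul, hx, mul_zero]
        | D_mul x hx => rw [mul_assoc, coeff_zero_D_mul, hx, map_zero]
        | one => rw [one_mul, D, coeff_ofPoly, Polynomial.coeff_X_zero]
      rw [h0, zero_add]
    | succ j => rw [coeff_succ_D_mul, hx]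
  | one =>
    rw [one_mul, D, coeff_ofPoly, ← C_one, coeff_C, Polynomial.coeff_X]
    split_ifs <;> first | rfl | omega

section map

variable {K' : Type*} [CommRing K'] [Differential K']

/-- The homomorphism of rings of differential operators induced by a homomorphism of differential
rings. -/
def map (h : K →+* K') (hd : ∀ a, h (a′) = (h a)′) : DiffOp K →+* DiffOp K' where
  toFun x := ofPoly (((ofPoly (K := K)).symm x).map h)
  map_zero' := by simp
  map_one' := Polynomial.map_one h
  map_add' x y := by simp
  map_mul' x y := by
    have hcoeff (j : ℕ) (x : DiffOp K) :
        coeff j (ofPoly (((ofPoly (K := K)).symm x).map h)) = h (coeff j x) :=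
      Polynomial.coeff_map _ _
    induction x using induction_on generalizing y with
    | add x x' hx hx' => rw [add_mul, map_add, Polynomial.map_add, map_add, hx, hx', map_add,
        Polynomial.map_add, map_add, add_mul]
    | C_mul a x hx =>
      have hC (z : DiffOp K) : ofPoly (((ofPoly (K := K)).symm (C a * z)).map h) =
          C (h a) * ofPoly (((ofPoly (K := K)).symm z).map h) := by
        refine ext_coeff fun j => ?_
        rw [hcoeff, coeff_C_mul, coeff_C_mul, hcoeff, map_mul]
      rw [mul_assoc, hC, hx, hC, mul_assoc]
    | D_mul x hx =>
      have hC (z : DiffOp K) : ofPoly (((ofPoly (K := K)).symm (D * z)).map h) =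
          D * ofPoly (((ofPoly (K := K)).symm z).map h) := by
        refine ext_coeff fun j => ?_
        cases j with
        | zero => rw [hcoeff, coeff_zero_D_mul, coeff_zero_D_mul, hcoeff, hd]
        | succ j => rw [hcoeff, coeff_succ_D_mul, coeff_succ_D_mul, hcoeff, hcoeff, map_add, hd]
      rw [mul_assoc, hC, hx, hC, mul_assoc]
    | one =>
      rw [one_mul]
      refine Eq.trans (one_mul _).symm (congrArg (· * _) ?_)
      exact (Polynomial.map_one h).symm

variable (h : K →+* K') (hd : ∀ a, h (a′) = (h a)′)

theorem map_C (a : K) : map h hd (C a) = C (h a) := Polynomial.map_C h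

theorem map_D : map h hd D = D := Polynomial.map_X h

end map

/-! ### Division by a first-order matrix with invertible leading part. -/

section firstOrder

open Matrix

variable {q n : ℕ} {P₀ P₁ : Matrix (Fin q) (Fin n) K} {P : Matrix (Fin q) (Fin n) (DiffOp K)}
  {B : Matrix (Fin n) (Fin q) K}

/-- `B` is constant, so it passes through `d/dt` without a derivative term and the product is again
a first-order matrix. -/
theorem firstOrder_mul (hP : ∀ i k, P i k = C (P₀ i k) + C (P₁ i k) * D)
    (hB : ∀ k s, (B k s)′ = 0) (i s : Fin q) :
    (P * B.map CHom) i s = C ((P₀ * B) i s) + C ((P₁ * B) i s) * D := by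
  simp only [Matrix.mul_apply, Matrix.map_apply, ← CHom_apply, map_sum, Finset.sum_mul,
    ← Finset.sum_add_distrib]
  refine Finset.sum_congr rfl fun k _ => ?_
  rw [hP, add_mul, mul_assoc]
  simp only [CHom_apply]
  rw [D_mul_C, hB, C_zero, add_zero, ← mul_assoc, C_mul, C_mul]

/-- After the invertible matrix `P₁ B` is factored out, `P B` becomes the monic operator `M + d/dt`,
and multiplying a nonzero row by a monic operator raises its order: the top coefficient survives. -/
theorem eq_zero_of_vecMul_eq_zero (hP : ∀ i k, P i k = C (P₀ i k) + C (P₁ i k) * D)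
    (hB : ∀ k s, (B k s)′ = 0) (hu : IsUnit (P₁ * B)) {c : Fin q → DiffOp K}
    (hc : c ᵥ* P = 0) : c = 0 := by
  obtain ⟨N, hN⟩ := hu
  set Nm : Matrix (Fin q) (Fin q) (DiffOp K) := (N : Matrix (Fin q) (Fin q) K).map CHom with hNm
  set Ni : Matrix (Fin q) (Fin q) (DiffOp K) := (N⁻¹ : (Matrix (Fin q) (Fin q) K)ˣ).val.map CHom
    with hNi
  have h1 : Nm * Ni = 1 := by
    rw [hNm, hNi, ← Matrix.map_mul, Units.mul_inv, Matrix.map_one _ (map_zero _) (map_one _)]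
  have h2 : Ni * Nm = 1 := by
    rw [hNm, hNi, ← Matrix.map_mul, Units.inv_mul, Matrix.map_one _ (map_zero _) (map_one _)]
  set c' := c ᵥ* Nm with hc'
  have hcc' : c = c' ᵥ* Ni := by rw [hc', Matrix.vecMul_vecMul, h1, Matrix.vecMul_one]
  suffices h : c' = 0 by rw [hcc', h, Matrix.zero_vecMul]
  set M : Matrix (Fin q) (Fin q) K := (N⁻¹ : (Matrix (Fin q) (Fin q) K)ˣ).val * (P₀ * B) with hM
  have key : c' ᵥ* (M.map CHom) + (fun s => c' s * D) = 0 := by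
    have h3 : c ᵥ* (P * B.map CHom) = 0 := by
      rw [← Matrix.vecMul_vecMul, hc, Matrix.zero_vecMul]
    have h4 : P * B.map CHom = Nm * (M.map CHom + Matrix.diagonal fun _ => D) := by
      rw [mul_add, hNm, ← Matrix.map_mul, hM, ← mul_assoc, Units.mul_inv, one_mul]
      ext i s
      rw [firstOrder_mul hP hB, Matrix.add_apply, Matrix.mul_diagonal, ← hN]
      rfl
    rw [h4, ← Matrix.vecMul_vecMul, ← hc', Matrix.vecMul_add] at h3
    rw [← h3]
    congr 1
    ext s
    rw [Matrix.vecMul_diagonal]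
  have hdeg : ∃ d, ∀ s, ∀ j ≥ d, coeff j (c' s) = 0 := by
    choose d hd using fun s => exists_forall_ge_coeff_eq_zero (c' s)
    exact ⟨Finset.univ.sup d, fun s j hj => hd s j ((Finset.le_sup (Finset.mem_univ s)).trans hj)⟩
  obtain ⟨d, hd⟩ := hdeg
  have h0 : ∀ s, ∀ j ≥ 0, coeff j (c' s) = 0 := by
    -- Descent on a bound for the order: if `c'` vanishes in the degrees `≥ d + 1`, so does `c' M`,
    -- and the coefficient of degree `j + 1` of `key`, for `j ≥ d`, reduces to coefficient `j` of
    -- `c'`.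
    induction d with
    | zero => exact hd
    | succ d ih =>
      refine ih fun s j hj => ?_
      have h := congrArg (fun w => coeff (j + 1) (w s)) key
      simp only [Pi.add_apply, map_add, Pi.zero_apply, map_zero] at h
      rw [coeff_succ_mul_D, Matrix.vecMul, dotProduct, map_sum, Finset.sum_eq_zero, zero_add] at h
      · exact h
      · intro t _
        exact coeff_mul_C_eq_zero _ _ (d + 1) (hd t) _ (by omega)
  funext s
  exact ext_coeff fun j => by rw [h0 s j (Nat.zero_le j)]; simp

theorem exists_vecMul_sub_order_zero (hP : ∀ i k, P i k = C (P₀ i k) + C (P₁ i k) * D)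
    (hB : ∀ k s, (B k s)′ = 0) (hu : IsUnit (P₁ * B)) (w : Fin n → DiffOp K) :
    ∃ (c : Fin q → DiffOp K) (a : Fin q → K),
      (w - c ᵥ* P) ᵥ* B.map CHom = fun s => C (a s) := by
  obtain ⟨N, hN⟩ := hu
  let Good : (Fin n → DiffOp K) → Prop := fun w => ∃ (c : Fin q → DiffOp K) (a : Fin q → K),
      (w - c ᵥ* P) ᵥ* B.map CHom = fun s => C (a s)
  have hadd (v w) (hv : Good v) (hw : Good w) : Good (v + w) := by
    obtain ⟨c, a, h⟩ := hv
    obtain ⟨c', a', h'⟩ := hw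
    refine ⟨c + c', a + a', ?_⟩
    rw [Matrix.add_vecMul, add_sub_add_comm, Matrix.add_vecMul, h, h']
    funext s
    exact (C_add _ _).symm
  have hzero : Good 0 := ⟨0, 0, by
    simp only [Matrix.zero_vecMul, sub_zero, Pi.zero_apply, C_zero]; rfl⟩
  have hC (b : K) (w) (hw : Good w) : Good (C b • w) := by
    obtain ⟨c, a, h⟩ := hw
    refine ⟨C b • c, b • a, ?_⟩
    rw [Matrix.smul_vecMul, ← smul_sub, Matrix.smul_vecMul, h]
    funext s
    exact (C_mul _ _).symm
  have hD (w) (hw : Good w) : Good ((D : DiffOp K) • w) := by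
    obtain ⟨c, a, h⟩ := hw
    -- Left multiplication turns the remainder `a` into `a (d/dt) + a′`. The row `e` solves `e (P₁
    -- B) = a`, so that subtracting `e P` removes the first-order term.
    set e : Fin q → K := a ᵥ* (N⁻¹ : (Matrix (Fin q) (Fin q) K)ˣ).val with he
    refine ⟨(D : DiffOp K) • c + fun i => C (e i), fun s => (a s)′ - (e ᵥ* (P₀ * B)) s, ?_⟩
    rw [Matrix.add_vecMul, ← sub_sub, Matrix.smul_vecMul, ← smul_sub, Matrix.sub_vecMul,
      Matrix.smul_vecMul, h, Matrix.vecMul_vecMul]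
    funext s
    have h1 : ((fun i => C (e i)) ᵥ* (P * B.map CHom)) s =
        C ((e ᵥ* (P₀ * B)) s) + C (a s) * D := by
      have h2 : a s = (e ᵥ* (P₁ * B)) s := by
        rw [he, Matrix.vecMul_vecMul, ← hN, Units.inv_mul, Matrix.vecMul_one]
      rw [h2]
      simp only [Matrix.vecMul, dotProduct, firstOrder_mul hP hB, mul_add, ← mul_assoc, ← C_mul]
      simp only [← CHom_apply, map_sum, Finset.sum_mul, Finset.sum_add_distrib]
    rw [Pi.sub_apply, h1, Pi.smul_apply, smul_eq_mul, D_mul_C]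
    simp only [← CHom_apply, map_sub]
    abel
  have hsmul (x : DiffOp K) (w) (hw : Good w) : Good (x • w) := by
    induction x using induction_on with
    | add x y hx hy => rw [add_smul]; exact hadd _ _ hx hy
    | C_mul a x hx => rw [mul_smul]; exact hC _ _ hx
    | D_mul x hx => rw [mul_smul]; exact hD _ hx
    | one => rwa [one_smul]
  have hsingle (k : Fin n) : Good (Pi.single k 1) := by
    refine ⟨0, B k, ?_⟩
    rw [Matrix.zero_vecMul, sub_zero, Matrix.single_one_vecMul]
    rfl
  have hw : w = ∑ k, w k • (Pi.single k 1 : Fin n → DiffOp K) := by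
    funext k
    simp [Finset.sum_apply, Pi.single_apply]
  rw [hw]
  exact Finset.sum_induction _ Good hadd hzero fun k _ => hsmul _ _ (hsingle k)

end firstOrder

end DiffOp

/-! ### Hyper-regularity and freeness from a block inverse. -/

section BlockInverse

open Matrix

variable {R : Type*} [Ring R] {q m n : ℕ}
  {P : Matrix (Fin q) (Fin n) R} {T : Matrix (Fin m) (Fin n) R}
  {Q : Matrix (Fin n) (Fin m) R} {W : Matrix (Fin n) (Fin q) R}

/-- The five identities say that `P` stacked over `T` is inverse to `(W, Q)`. With `V = 1` and `U =
(W, Q)` one has `P U = (P W, P Q) = (1, 0)`. -/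
theorem isHyperRegular_of_block_inverse (hn : q + m = n) (hPQ : P * Q = 0) (hTQ : T * Q = 1)
    (hPW : P * W = 1) (hTW : T * W = 0) (hWQ : W * P + Q * T = 1) : IsHyperRegular P := by
  let e : Fin q ⊕ Fin m ≃ Fin n := finSumFinEquiv.trans (finCongr hn)
  have hmul : (fromRows P T).submatrix e.symm id * (fromCols W Q).submatrix id e.symm = 1 := by
    rw [← submatrix_mul _ _ _ _ _ Function.bijective_id, fromRows_mul_fromCols, hPQ, hTQ,
      hPW, hTW, fromBlocks_one, submatrix_one_equiv]
  have hmul' : (fromCols W Q).submatrix id e.symm * (fromRows P T).submatrix e.symm id = 1 := by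
    rw [submatrix_mul_equiv, fromCols_mul_fromRows, hWQ, submatrix_id_id]
  refine ⟨1, ⟨(fromCols W Q).submatrix id e.symm, (fromRows P T).submatrix e.symm id,
    hmul', hmul⟩, ?_⟩
  rw [Units.val_one, Matrix.one_mul]
  change P * (fromCols W Q).submatrix id e.symm = _
  have h : P * (fromCols W Q).submatrix id e.symm =
      (fromCols (1 : Matrix (Fin q) (Fin q) R) (0 : Matrix (Fin q) (Fin m) R)).submatrix id
        e.symm := by
    rw [← hPW, ← hPQ, ← mul_fromCols]
    rfl
  rw [h]
  ext i j
  obtain ⟨x, rfl⟩ := e.surjective j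
  rw [submatrix_apply, Equiv.symm_apply_apply, of_apply]
  cases x with
  | inl a =>
    have : ((e (Sum.inl a) : Fin n) : ℕ) = a := by simp [e]
    rw [this, fromCols_apply_inl, one_apply]
    simp [Fin.ext_iff]
  | inr b =>
    have : ((e (Sum.inr b) : Fin n) : ℕ) = q + b := by simp [e]
    rw [this, fromCols_apply_inr, if_neg (by omega)]
    rfl

/-- Right multiplication by `Q` has the section `T`, and its kernel is the row module of `P` because
`w = w W P + w Q T`. -/
theorem free_quotient_of_block_inverse (hPQ : P * Q = 0) (hTQ : T * Q = 1)
    (hWQ : W * P + Q * T = 1) :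
    Module.Free R ((Fin n → R) ⧸ Submodule.span R (Set.range fun i => P i)) := by
  let f : (Fin n → R) →ₗ[R] (Fin m → R) := Q.vecMulLinear
  have hf (w) : f w = w ᵥ* Q := rfl
  have hsurj : Function.Surjective f := fun v => ⟨v ᵥ* T, by
    rw [hf, vecMul_vecMul, hTQ, vecMul_one]⟩
  have hker : Submodule.span R (Set.range fun i => P i) = LinearMap.ker f := by
    have hrange : Submodule.span R (Set.range fun i => P i) = LinearMap.range P.vecMulLinear :=
      (range_vecMulLinear P).symm
    rw [hrange]
    ext w
    constructor
    · rintro ⟨v, rfl⟩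
      rw [LinearMap.mem_ker, hf, vecMulLinear_apply, vecMul_vecMul, hPQ, vecMul_zero]
    · intro hw
      rw [LinearMap.mem_ker, hf] at hw
      refine ⟨w ᵥ* W, ?_⟩
      rw [vecMulLinear_apply, vecMul_vecMul]
      have h := congrArg (w ᵥ* ·) hWQ
      simp only [vecMul_add, vecMul_one] at h
      rwa [← vecMul_vecMul w Q T, hw, zero_vecMul, add_zero] at h
  rw [hker]
  exact Module.Free.of_equiv (f.quotKerEquivOfSurjective hsurj).symm

end BlockInverse

/-! ### Functions of bounded order, directional derivatives and prolongations. -/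

namespace Jet

variable {n p : ℕ}

/-- Near `z`, the function `f` is a real-analytic function of the coordinates of order less than
`r`. -/
def OrderLE (r : ℕ) (f : Jet n → ℝ) (z : Jet n) : Prop :=
  ∃ g : (Fin r → Fin n → ℝ) → ℝ, AnalyticAt ℝ g (trunc r z) ∧ f =ᶠ[𝓝 z] fun w => g (trunc r w)

theorem OrderLE.analyticNear {r : ℕ} {f : Jet n → ℝ} {z : Jet n} (h : OrderLE r f z) :
    AnalyticNear f z := ⟨r, h⟩

theorem OrderLE.mono {r s : ℕ} {f : Jet n → ℝ} {z : Jet n} (h : OrderLE r f z) (hrs : r ≤ s) :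
    OrderLE s f z := by
  obtain ⟨g, hg, hfg⟩ := h
  refine ⟨g ∘ resL n hrs, AnalyticAt.comp ?_ ((resL n _).analyticAt _), hfg⟩
  rwa [resL_trunc]

theorem OrderLE.eventually {r : ℕ} {f : Jet n → ℝ} {z : Jet n} (h : OrderLE r f z) :
    ∀ᶠ w in 𝓝 z, OrderLE r f w := by
  obtain ⟨g, hg, hfg⟩ := h
  filter_upwards [(continuous_trunc r).continuousAt.eventually hg.eventually_analyticAt,
    hfg.eventually_nhds] with w h1 h2
  exact ⟨g, h1, h2⟩

theorem exists_forall_orderLE {ι : Type*} [Finite ι] {f : ι → Jet n → ℝ} {z : Jet n}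
    (h : ∀ i, AnalyticNear (f i) z) : ∃ r, ∀ i, OrderLE r (f i) z := by
  cases nonempty_fintype ι
  choose r hr using h
  exact ⟨Finset.univ.sup r, fun i => OrderLE.mono (hr i) (Finset.le_sup (Finset.mem_univ i))⟩

theorem AnalyticNear.continuousAt {f : Jet n → ℝ} {z : Jet n} (h : AnalyticNear f z) :
    ContinuousAt f z := by
  obtain ⟨r, g, hg, hfg⟩ := h
  have h1 : ContinuousAt (fun w => g (trunc r w)) z :=
    ContinuousAt.comp (f := trunc r) (g := g) hg.continuousAt (continuous_trunc r).continuousAt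
  exact h1.congr hfg.symm

theorem trunc_eq_sum (r : ℕ) (v : Jet n) :
    trunc r v = ∑ j ∈ Finset.range r, ∑ k, v j k • trunc r (Pi.single j (Pi.single k 1)) := by
  funext j k
  simp only [Finset.sum_apply, Pi.smul_apply, smul_eq_mul, trunc]
  rw [Finset.sum_eq_single (j : ℕ), Finset.sum_eq_single k]
  · simp
  · intro l _ hl
    simp [hl.symm]
  · simp
  · intro l _ hl
    simp [Pi.single_eq_of_ne hl.symm]
  · intro h
    exact absurd (Finset.mem_range.2 j.2) h

theorem OrderLE.pderiv_eq_zero {r : ℕ} {f : Jet n → ℝ} {z : Jet n} (h : OrderLE r f z) {j : ℕ}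
    (hj : r ≤ j) (k : Fin n) : pderiv f j k z = 0 := by
  obtain ⟨g, hg, hfg⟩ := h
  have h0 : trunc r (Pi.single j (Pi.single k (1 : ℝ))) = 0 := by
    funext i
    exact Pi.single_eq_of_ne (M := fun _ => Fin n → ℝ) (by omega) _
  rw [pderiv, (hasLineDerivAt_of_eventuallyEq hg hfg _).lineDeriv, h0, map_zero]

theorem OrderLE.lineDeriv_eq_sum {r : ℕ} {f : Jet n → ℝ} {z : Jet n} (h : OrderLE r f z)
    (v : Jet n) :
    lineDeriv ℝ f z v = ∑ j ∈ Finset.range r, ∑ k, pderiv f j k z * v j k := by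
  obtain ⟨g, hg, hfg⟩ := h
  simp only [pderiv, (hasLineDerivAt_of_eventuallyEq hg hfg _).lineDeriv]
  conv_lhs => rw [trunc_eq_sum r v]
  simp only [map_sum, map_smul, smul_eq_mul, mul_comm]

/-- Near `γ t` only finitely many coordinates enter, so differentiability of each coordinate of the
curve is enough; it also gives continuity for the product topology. -/
theorem AnalyticNear.hasDerivAt_comp {f : Jet n → ℝ} {γ : ℝ → Jet n} {v : Jet n} {t : ℝ}
    (hf : AnalyticNear f (γ t)) (hγ : ∀ j i, HasDerivAt (fun s => γ s j i) (v j i) t) :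
    HasDerivAt (fun s => f (γ s)) (lineDeriv ℝ f (γ t) v) t := by
  obtain ⟨r, g, hg, hfg⟩ := hf
  have hc : ContinuousAt γ t :=
    continuousAt_pi.2 fun j => continuousAt_pi.2 fun i => (hγ j i).continuousAt
  rw [(hasLineDerivAt_of_eventuallyEq hg hfg v).lineDeriv]
  have h1 : HasDerivAt (fun s => trunc r (γ s)) (trunc r v) t :=
    hasDerivAt_pi.2 fun j => hasDerivAt_pi.2 fun i => hγ j i
  exact (hg.differentiableAt.hasFDerivAt.comp_hasDerivAt t h1).congr_of_eventuallyEq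
    (hc.eventually hfg)

theorem shift_single_zero (a : Fin n → ℝ) : shift (Pi.single 0 a : Jet n) = 0 := by
  funext j
  exact Pi.single_eq_of_ne (M := fun _ => Fin n → ℝ) (Nat.succ_ne_zero j) _

theorem shift_single_succ (j : ℕ) (a : Fin n → ℝ) :
    shift (Pi.single (j + 1) a : Jet n) = Pi.single j a := by
  funext i
  simp only [shift, Pi.single_apply, Nat.add_right_cancel_iff]

/-- Derivative of `df/dt` in a fixed direction. -/
theorem AnalyticNear.lineDeriv_cartan {f : Jet n → ℝ} {z : Jet n} (hf : AnalyticNear f z)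
    (v : Jet n) : lineDeriv ℝ (Jet.cartan f) z v =
      Jet.cartan (fun w => lineDeriv ℝ f w v) z + lineDeriv ℝ f z (shift v) := by
  obtain ⟨r, g, hg, hfg⟩ := hf
  have hev : ∀ᶠ w in 𝓝 z, AnalyticAt ℝ g (trunc r w) ∧ f =ᶠ[𝓝 w] fun w => g (trunc r w) :=
    ((continuous_trunc r).continuousAt.eventually hg.eventually_analyticAt).and hfg.eventually_nhds
  have h1 : HasFDerivAt (fderiv ℝ g) (fderiv ℝ (fderiv ℝ g) (trunc r z)) (trunc r z) :=
    hg.fderiv.differentiableAt.hasFDerivAt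
  have hline (u : Jet n) : HasDerivAt (fun t : ℝ => trunc r (z + t • u)) (trunc r u) 0 := by
    refine hasDerivAt_pi.2 fun j => hasDerivAt_pi.2 fun i => ?_
    have := ((hasDerivAt_id (0 : ℝ)).mul_const (u j i)).const_add (z j i)
    simpa [trunc] using this
  have hlineS (u : Jet n) :
      HasDerivAt (fun t : ℝ => trunc r (shift (z + t • u))) (trunc r (shift u)) 0 := by
    refine hasDerivAt_pi.2 fun j => hasDerivAt_pi.2 fun i => ?_
    have := ((hasDerivAt_id (0 : ℝ)).mul_const (u (j + 1) i)).const_add (z (j + 1) i)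
    simpa [trunc, shift] using this
  have hlim (u : Jet n) : Tendsto (fun t : ℝ => z + t • u) (𝓝 0) (𝓝 z) := by
    have : Continuous fun t : ℝ => z + t • u := by fun_prop
    simpa using this.tendsto 0
  have hcomp (u : Jet n) : HasDerivAt (fun t : ℝ => fderiv ℝ g (trunc r (z + t • u)))
      (fderiv ℝ (fderiv ℝ g) (trunc r z) (trunc r u)) 0 := by
    have hz : trunc r (z + (0 : ℝ) • u) = trunc r z := by simp
    have h1' := h1
    rw [← hz] at h1'
    have := h1'.comp_hasDerivAt (0 : ℝ) (hline u)
    rwa [hz] at this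
  have hA : HasDerivAt (fun t : ℝ => Jet.cartan f (z + t • v))
      (fderiv ℝ (fderiv ℝ g) (trunc r z) (trunc r v) (trunc r (shift z)) +
        fderiv ℝ g (trunc r z) (trunc r (shift v))) 0 := by
    have h2 := (hcomp v).clm_apply (hlineS v)
    simp only [zero_smul, add_zero] at h2
    refine h2.congr_of_eventuallyEq ?_
    filter_upwards [(hlim v).eventually hev] with t ht
    exact (hasLineDerivAt_of_eventuallyEq ht.1 ht.2 _).lineDeriv
  have hB : HasDerivAt (fun t : ℝ => lineDeriv ℝ f (z + t • shift z) v)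
      (fderiv ℝ (fderiv ℝ g) (trunc r z) (trunc r (shift z)) (trunc r v)) 0 := by
    have h2 := (hcomp (shift z)).clm_apply (hasDerivAt_const (0 : ℝ) (trunc r v))
    simp only [map_zero, add_zero] at h2
    refine h2.congr_of_eventuallyEq ?_
    filter_upwards [(hlim (shift z)).eventually hev] with t ht
    exact (hasLineDerivAt_of_eventuallyEq ht.1 ht.2 _).lineDeriv
  -- `hA` and `hB` contain the second derivative of `g` on `v` and `shift z` in opposite orders; by
  -- symmetry they differ only by the term in which `shift` itself is differentiated.
  have hsymm : IsSymmSndFDerivAt ℝ g (trunc r z) :=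
    hg.contDiffAt.isSymmSndFDerivAt (n := ⊤) (by simp)
  rw [lineDeriv, hA.deriv, Jet.cartan, lineDeriv, hB.deriv,
    (hasLineDerivAt_of_eventuallyEq hg hfg _).lineDeriv, hsymm.eq]

theorem AnalyticNear.pderiv_zero_cartan {f : Jet n → ℝ} {z : Jet n} (hf : AnalyticNear f z)
    (k : Fin n) : Jet.pderiv (Jet.cartan f) 0 k z = Jet.cartan (Jet.pderiv f 0 k) z := by
  refine (hf.lineDeriv_cartan _).trans ?_
  rw [shift_single_zero]
  simp [lineDeriv]
  rfl

/-- The commutator of `∂/∂x⁽ʲ⁺¹⁾` with `d/dt` is `∂/∂x⁽ʲ⁾`. This is the same rule as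
`DiffOp.coeff_succ_D_mul`, which is why operators encode differentials. -/
theorem AnalyticNear.pderiv_succ_cartan {f : Jet n → ℝ} {z : Jet n} (hf : AnalyticNear f z)
    (j : ℕ) (k : Fin n) : Jet.pderiv (Jet.cartan f) (j + 1) k z =
      Jet.pderiv f j k z + Jet.cartan (Jet.pderiv f (j + 1) k) z := by
  refine (hf.lineDeriv_cartan _).trans ?_
  rw [shift_single_succ, add_comm]
  rfl

/-- The infinite prolongation of the map with components `θᵢ`: its component of index `(j, i)` is
`dʲθᵢ/dtʲ`. -/
def prolong (θ : Fin p → Jet n → ℝ) (z : Jet n) : Jet p := fun j i => cartan^[j] (θ i) z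

theorem continuousAt_prolong {θ : Fin p → Jet n → ℝ} {z : Jet n}
    (hθ : ∀ i, AnalyticNear (θ i) z) : ContinuousAt (prolong θ) z :=
  continuousAt_pi.2 fun j => continuousAt_pi.2 fun i => ((hθ i).cartan_iterate j).continuousAt

theorem AnalyticNear.comp_prolong {θ : Fin p → Jet n → ℝ} {z : Jet n} {g : Jet p → ℝ}
    (hg : AnalyticNear g (prolong θ z)) (hθ : ∀ i, AnalyticNear (θ i) z) :
    AnalyticNear (fun w => g (prolong θ w)) z := by
  obtain ⟨s, G, hG, hgG⟩ := hg
  obtain ⟨r, hr⟩ := exists_forall_orderLE (ι := Fin s × Fin p)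
    (f := fun x => Jet.cartan^[(x.1 : ℕ)] (θ x.2)) (z := z) fun x => (hθ x.2).cartan_iterate x.1
  choose k hk hfk using hr
  have hz : (fun (j : Fin s) (i : Fin p) => k (j, i) (trunc r z)) = trunc s (prolong θ z) := by
    funext j i
    exact ((hfk (j, i)).eq_of_nhds).symm
  refine ⟨r, fun a => G fun j i => k (j, i) a, ?_, ?_⟩
  · refine AnalyticAt.fun_comp (g := G) (f := fun a j i => k (j, i) a) (by rwa [hz]) ?_
    exact AnalyticAt.pi fun j => AnalyticAt.pi fun i => hk (j, i)
  · filter_upwards [(continuousAt_prolong hθ).eventually hgG, eventually_all.2 hfk] with w h1 h2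
    rw [h1]
    congr 1
    funext j i
    exact h2 (j, i)

theorem AnalyticNear.lineDeriv_comp_prolong {θ : Fin p → Jet n → ℝ} {z : Jet n} {g : Jet p → ℝ}
    (hg : AnalyticNear g (prolong θ z)) (hθ : ∀ i, AnalyticNear (θ i) z) (v : Jet n) :
    lineDeriv ℝ (fun w => g (prolong θ w)) z v =
      lineDeriv ℝ g (prolong θ z) fun j i => lineDeriv ℝ (Jet.cartan^[j] (θ i)) z v := by
  have hz : z + (0 : ℝ) • v = z := by simp
  have h := AnalyticNear.hasDerivAt_comp (f := g) (γ := fun t : ℝ => prolong θ (z + t • v)) (t := 0)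
    (v := fun j i => lineDeriv ℝ (Jet.cartan^[j] (θ i)) z v) (by simpa [hz] using hg)
    fun j i => ((hθ i).cartan_iterate j).hasLineDerivAt v
  simp only [hz] at h
  exact h.deriv

/-- A prolongation maps the Cartan field to the Cartan field: the derivative of `dʲθ/dtʲ` along it
is the next component of the prolongation. -/
theorem AnalyticNear.cartan_comp_prolong {θ : Fin p → Jet n → ℝ} {z : Jet n} {g : Jet p → ℝ}
    (hg : AnalyticNear g (prolong θ z)) (hθ : ∀ i, AnalyticNear (θ i) z) :
    Jet.cartan (fun w => g (prolong θ w)) z = Jet.cartan g (prolong θ z) := by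
  refine (hg.lineDeriv_comp_prolong hθ _).trans ?_
  rw [Jet.cartan]
  congr 1
  funext j i
  change Jet.cartan (Jet.cartan^[j] (θ i)) z = Jet.cartan^[j + 1] (θ i) z
  rw [Function.iterate_succ_apply']

/-- The coordinate `xᵢ⁽ʲ⁾`. -/
def coord (j : ℕ) (i : Fin n) (z : Jet n) : ℝ := z j i

theorem orderLE_coord (j : ℕ) (i : Fin n) (z : Jet n) : OrderLE (j + 1) (coord j i) z :=
  ⟨fun a => a (Fin.last j) i, ((ContinuousLinearMap.proj (R := ℝ) i).comp
    (ContinuousLinearMap.proj (R := ℝ) (φ := fun _ : Fin (j + 1) => Fin n → ℝ)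
      (Fin.last j))).analyticAt _, Eventually.of_forall fun _ => rfl⟩

theorem hasLineDerivAt_coord (j : ℕ) (i : Fin n) (z v : Jet n) :
    HasLineDerivAt ℝ (coord j i) (v j i) z v := by
  have := ((hasDerivAt_id (0 : ℝ)).mul_const (v j i)).const_add (z j i)
  simpa [HasLineDerivAt, coord] using this

theorem cartan_iterate_coord (j : ℕ) (i : Fin n) : cartan^[j] (coord 0 i) = coord j i := by
  induction j with
  | zero => rfl
  | succ j ih =>
    rw [Function.iterate_succ_apply', ih]
    funext z
    exact (hasLineDerivAt_coord j i z _).lineDeriv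

/-- Makes the ordinary differential of a function the special case `θ = coord 0` of a differential
taken along a prolongation. -/
theorem prolong_coord (z : Jet n) : prolong (coord 0) z = z := by
  funext j i
  rw [prolong, cartan_iterate_coord]
  rfl

theorem pderiv_coord (j : ℕ) (i : Fin n) (l : ℕ) (k : Fin n) (z : Jet n) :
    pderiv (coord j i) l k z = if l = j ∧ k = i then 1 else 0 := by
  rw [pderiv, (hasLineDerivAt_coord j i z _).lineDeriv, Pi.single_apply]
  by_cases h : j = l <;> simp [h, Pi.single_apply, eq_comm]

end Jet

/-! ### Differentiable families of invertible matrices. -/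

theorem DifferentiableAt.matrix_det {ι : Type*} [Fintype ι] [DecidableEq ι]
    {M : ℝ → Matrix ι ι ℝ} {t : ℝ} (hM : ∀ i j, DifferentiableAt ℝ (fun s => M s i j) t) :
    DifferentiableAt ℝ (fun s => (M s).det) t := by
  simp only [Matrix.det_apply]
  refine DifferentiableAt.fun_sum fun σ _ => ?_
  refine DifferentiableAt.const_smul ?_ _
  exact DifferentiableAt.fun_finsetProd fun i _ => hM _ _

theorem DifferentiableAt.matrix_inv {ι : Type*} [Fintype ι] [DecidableEq ι]
    {M : ℝ → Matrix ι ι ℝ} {t : ℝ} (hM : ∀ i j, DifferentiableAt ℝ (fun s => M s i j) t)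
    (hu : IsUnit (M t)) (i j : ι) : DifferentiableAt ℝ (fun s => (M s)⁻¹ i j) t := by
  simp only [Matrix.inv_def, Matrix.smul_apply, Ring.inverse_eq_inv', smul_eq_mul,
    Matrix.adjugate_apply]
  have hdet : (M t).det ≠ 0 := ((Matrix.isUnit_iff_isUnit_det _).1 hu).ne_zero
  refine ((DifferentiableAt.matrix_det hM).inv hdet).mul (DifferentiableAt.matrix_det fun k l => ?_)
  simp only [Matrix.updateRow_apply]
  split_ifs
  · exact differentiableAt_const _
  · exact hM k l

theorem Matrix.isInvertible_mulVec {ι : Type*} [Fintype ι] [DecidableEq ι] {M : Matrix ι ι ℝ}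
    (hM : IsUnit M) {f : (ι → ℝ) →L[ℝ] (ι → ℝ)} (hf : ∀ b, f b = M.mulVec b) :
    f.IsInvertible := by
  have hdet : IsUnit M.det := (Matrix.isUnit_iff_isUnit_det _).1 hM
  refine ⟨(Matrix.toLinearEquiv' M
    (Matrix.invertibleOfIsUnitDet M hdet)).toContinuousLinearEquiv, ?_⟩
  ext1 b
  rw [hf]
  rfl

/-! ### Curves in the locus through a regular point. -/

namespace ImplicitSystem

open Jet Matrix

variable {n q : ℕ} (S : ImplicitSystem n q)

/-- The matrix `∂F/∂ẋ` at a jet. -/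
def leading (z : Jet n) : Matrix (Fin q) (Fin n) ℝ :=
  Matrix.of fun i k => pderiv (S.eqn i) 1 k z

variable {S}

theorem eventually_mem_dom {z : Jet n} (hz : (z 0, z 1) ∈ S.dom) :
    ∀ᶠ w in 𝓝 z, (w 0, w 1) ∈ S.dom := by
  have h : Continuous fun w : Jet n => (w 0, w 1) := by fun_prop
  exact h.continuousAt.eventually (S.isOpen_dom.mem_nhds hz)

theorem hasLineDerivAt_eqn {z : Jet n} (hz : (z 0, z 1) ∈ S.dom) (i : Fin q) (v : Jet n) :
    HasLineDerivAt ℝ (S.eqn i) (fderiv ℝ S.F (z 0, z 1) (v 0, v 1) i) z v := by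
  have h0 (j : ℕ) : HasDerivAt (fun t : ℝ => (z + t • v) j) (v j) 0 := by
    have := ((hasDerivAt_id (0 : ℝ)).smul_const (v j)).const_add (z j)
    simpa using this
  have h1 := (h0 0).prodMk (h0 1)
  have hF : HasFDerivAt S.F (fderiv ℝ S.F (z 0, z 1))
      ((z + (0 : ℝ) • v) 0, (z + (0 : ℝ) • v) 1) := by
    simpa using (S.analytic _ hz).differentiableAt.hasFDerivAt
  exact hasDerivAt_pi.1 (hF.comp_hasDerivAt (0 : ℝ) h1) i

theorem leading_apply {z : Jet n} (hz : (z 0, z 1) ∈ S.dom) (i : Fin q) (k : Fin n) :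
    S.leading z i k = fderiv ℝ S.F (z 0, z 1) (0, Pi.single k 1) i := by
  refine (hasLineDerivAt_eqn hz i _).lineDeriv.trans ?_
  simp

theorem leading_mulVec {z : Jet n} (hz : (z 0, z 1) ∈ S.dom) (a : Fin n → ℝ) :
    S.leading z *ᵥ a = fderiv ℝ S.F (z 0, z 1) (0, a) := by
  have ha : ((0, a) : (Fin n → ℝ) × (Fin n → ℝ)) = ∑ k, a k • (0, Pi.single k 1) := by
    refine Prod.ext ?_ ?_
    · simp [Prod.fst_sum]
    · rw [Prod.snd_sum]
      funext l
      simp [Finset.sum_apply, Pi.single_apply]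
  rw [ha, map_sum]
  funext i
  simp only [Matrix.mulVec, dotProduct, map_smul, Finset.sum_apply, Pi.smul_apply, smul_eq_mul,
    leading_apply hz, mul_comm]

theorem leading_congr {z w : Jet n} (hz : (z 0, z 1) ∈ S.dom) (h0 : w 0 = z 0) (h1 : w 1 = z 1) :
    S.leading w = S.leading z := by
  ext i k
  rw [leading_apply hz, leading_apply (by rwa [h0, h1]), h0, h1]

theorem eventually_isUnit_leading_mul {z : Jet n} (hz : (z 0, z 1) ∈ S.dom)
    {B : Matrix (Fin n) (Fin q) ℝ} (hB : IsUnit (S.leading z * B)) :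
    ∀ᶠ w in 𝓝 z, IsUnit (S.leading w * B) := by
  have h1 : ContinuousAt (fun w => (S.leading w * B).det) z := by
    have h2 : ContinuousAt (fun w => S.leading w * B) z := by
      refine continuousAt_pi.2 fun i => continuousAt_pi.2 fun s => ?_
      simp only [Matrix.mul_apply]
      exact tendsto_finsetSum _ fun l _ =>
        ((S.eqn_mem hz i).pderiv 1 l).continuousAt.mul continuousAt_const
    exact ContinuousAt.comp (g := Matrix.det) (continuous_id.matrix_det.continuousAt) h2
  have h3 : (S.leading z * B).det ≠ 0 := ((Matrix.isUnit_iff_isUnit_det _).1 hB).ne_zero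
  filter_upwards [h1.eventually_ne h3] with w hw
  exact (Matrix.isUnit_iff_isUnit_det _).2 hw.isUnit

/-- The equation `dᵏ⁺¹Fᵢ/dtᵏ⁺¹ = 0` is affine in the coordinates of order `k + 2`, with leading
matrix `∂F/∂ẋ`. -/
theorem cartan_iterate_eqn_add (k : ℕ) (i : Fin q) {u δ : Jet n} (hu : (u 0, u 1) ∈ S.dom)
    (hδ : ∀ j ≤ k + 1, δ j = 0) :
    cartan^[k + 1] (S.eqn i) (u + δ) =
      cartan^[k + 1] (S.eqn i) u + (S.leading u *ᵥ δ (k + 2)) i := by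
  induction k generalizing u δ with
  | zero =>
    have h0 : δ 0 = 0 := hδ 0 (by omega)
    have h1 : δ 1 = 0 := hδ 1 (by omega)
    rw [zero_add, Function.iterate_one, leading_mulVec hu]
    have hu' : ((u + δ) 0, (u + δ) 1) ∈ S.dom := by simpa [h0, h1] using hu
    rw [cartan, (hasLineDerivAt_eqn hu' i _).lineDeriv, cartan,
      (hasLineDerivAt_eqn hu i _).lineDeriv, ← Pi.add_apply, ← map_add]
    simp [shift, h0, h1]
  | succ k ih =>
    have hdom : ∀ᶠ t : ℝ in 𝓝 0, ((u + t • shift u) 0, (u + t • shift u) 1) ∈ S.dom := by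
      have hc : Continuous fun t : ℝ => u + t • shift u := by fun_prop
      have := hc.continuousAt (x := 0)
      exact this.eventually (eventually_mem_dom (by simpa using hu))
    -- The factor `t` vanishes at `0`, so the derivative of the leading matrix does not contribute.
    have hlead (l : Fin n) : HasDerivAt (fun t : ℝ => S.leading (u + t • shift u) i l *
        (t * δ (k + 3) l)) (S.leading u i l * δ (k + 3) l) 0 := by
      have h1 := ((S.eqn_mem hu i).pderiv 1 l).hasLineDerivAt (shift u)
      have h2 := HasDerivAt.fun_mul h1 ((hasDerivAt_id (0 : ℝ)).mul_const (δ (k + 3) l))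
      simpa [leading] using h2
    have hsum := HasDerivAt.add (((S.eqn_mem hu i).cartan_iterate (k + 1)).hasLineDerivAt (shift u))
      (HasDerivAt.fun_sum fun l (_ : l ∈ Finset.univ) => hlead l)
    rw [Function.iterate_succ_apply' cartan (k + 1)]
    refine (HasDerivAt.congr_of_eventuallyEq hsum ?_).deriv
    filter_upwards [hdom] with t ht
    -- The displacement `δ + t • shift δ` vanishes up to order `k + 1` and equals `t δ (k + 3)` at
    -- order `k + 2`, so the induction hypothesis applies along the Cartan line through `u`.
    have harg : u + δ + t • shift (u + δ) = (u + t • shift u) + (δ + t • shift δ) := by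
      funext j l
      simp only [shift, Pi.add_apply, Pi.smul_apply, smul_eq_mul]
      ring
    rw [harg, ih ht]
    · simp only [Pi.add_apply, Matrix.mulVec, dotProduct]
      congr 1
      refine Finset.sum_congr rfl fun l _ => ?_
      rw [Pi.smul_apply, Pi.smul_apply, hδ (k + 2) (by omega)]
      simp [shift]
    · intro j hj
      rw [Pi.add_apply, Pi.smul_apply, shift, hδ j (by omega), hδ (j + 1) (by omega)]
      simp

/-- The `k`-th derivative of an equation involves only the orders `≤ k + 1`. The statement is global
in the higher coordinates, so an infinitely corrected jet can be replaced by a finite stage of the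
correction. -/
theorem cartan_iterate_eqn_congr (k : ℕ) (i : Fin q) {u w : Jet n} (hu : (u 0, u 1) ∈ S.dom)
    (h : ∀ j ≤ k + 1, w j = u j) : cartan^[k] (S.eqn i) w = cartan^[k] (S.eqn i) u := by
  cases k with
  | zero =>
    simp only [Function.iterate_zero, id_eq, eqn]
    rw [h 0 (by omega), h 1 (by omega)]
  | succ k =>
    have h1 := cartan_iterate_eqn_add k i (u := u) (δ := w - u) hu fun j hj => by
      rw [Pi.sub_apply, h j (by omega), sub_self]
    rw [add_sub_cancel] at h1
    rw [h1, Pi.sub_apply, h (k + 2) (by omega), sub_self, Matrix.mulVec_zero]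
    simp

/-- Solution of the equation `F = 0` along a line, by the implicit function theorem. -/
theorem exists_implicit_curve {z : Jet n} (hz : z ∈ S.locus) {B : Matrix (Fin n) (Fin q) ℝ}
    (hB : IsUnit (S.leading z * B)) (a : Jet n) :
    ∃ ψ : ℝ → Fin q → ℝ, ψ 0 = 0 ∧ DifferentiableAt ℝ ψ 0 ∧
      ∀ᶠ t in 𝓝 0, S.F (z 0 + t • a 0, z 1 + t • a 1 + B *ᵥ ψ t) = 0 := by
  let Lm : ℝ × (Fin q → ℝ) →L[ℝ] (Fin n → ℝ) × (Fin n → ℝ) :=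
    ((ContinuousLinearMap.fst ℝ ℝ (Fin q → ℝ)).smulRight (a 0)).prod
      ((ContinuousLinearMap.fst ℝ ℝ (Fin q → ℝ)).smulRight (a 1) +
        (Matrix.toLin' B).toContinuousLinearMap.comp (ContinuousLinearMap.snd ℝ ℝ (Fin q → ℝ)))
  let f : ℝ × (Fin q → ℝ) → (Fin q → ℝ) := fun x => S.F ((z 0, z 1) + Lm x)
  have hF : HasStrictFDerivAt S.F (fderiv ℝ S.F (z 0, z 1)) ((z 0, z 1) + Lm 0) := by
    rw [map_zero, add_zero]
    exact (S.analytic _ hz.1).hasStrictFDerivAt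
  have hf : HasStrictFDerivAt f ((fderiv ℝ S.F (z 0, z 1)).comp Lm) 0 :=
    hF.comp 0 (Lm.hasStrictFDerivAt.const_add (z 0, z 1))
  -- The partial derivative in the unknown `b` is `(∂F/∂ẋ) B`.
  have hinv : ((fderiv ℝ S.F (z 0, z 1)).comp Lm ∘L .inr ℝ ℝ (Fin q → ℝ)).IsInvertible := by
    refine Matrix.isInvertible_mulVec hB fun b => ?_
    rw [← Matrix.mulVec_mulVec, leading_mulVec hz.1]
    simp [Lm]
  have hf0 : f 0 = 0 := by
    change S.F ((z 0, z 1) + Lm 0) = 0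
    rw [map_zero, add_zero]
    funext i
    exact hz.2 0 i
  refine ⟨hf.implicitFunctionOfProdDomain hinv, ?_, ?_, ?_⟩
  · exact (hf.eventually_apply_eq_iff_implicitFunctionOfProdDomain hinv).self_of_nhds.mp rfl
  · exact (hf.hasStrictFDerivAt_implicitFunctionOfProdDomain hinv).hasFDerivAt.differentiableAt
  · filter_upwards [hf.eventually_apply_implicitFunctionOfProdDomain hinv] with t ht
    rw [hf0] at ht
    rw [← ht]
    change _ = S.F ((z 0, z 1) + Lm (t, _))
    congr 1
    simp [Lm, add_assoc]

/-- The jet `z + t a`, corrected at the orders `≥ 1` by elements of the range of `B`. -/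
def correctedLine (z a : Jet n) (B : Matrix (Fin n) (Fin q) ℝ) (t : ℝ) (β : Jet q) : Jet n :=
  fun j => z j + t • a j + j.casesOn 0 fun j => B *ᵥ β j

/-- Successive determination of the corrections from the equations `dᵏF/dtᵏ = 0`. -/
def corrections (S : ImplicitSystem n q) (z a : Jet n) (B : Matrix (Fin n) (Fin q) ℝ)
    (ψ : ℝ → Fin q → ℝ) : ℕ → ℝ → Jet q
  | 0, t => Pi.single 0 (ψ t)
  | k + 1, t =>
    -- Entry `j` of the corrections acts at order `j + 1` of the jet. The new entry `k + 1` thus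
    -- acts at order `k + 2`, in which the `(k + 1)`-st derivative of the equations is affine, and
    -- it cancels the value at `u`.
    let u := correctedLine z a B t (corrections S z a B ψ k t)
    Function.update (corrections S z a B ψ k t) (k + 1)
      (-((S.leading u * B)⁻¹ *ᵥ fun i => cartan^[k + 1] (S.eqn i) u))

section

variable {z a : Jet n} {B : Matrix (Fin n) (Fin q) ℝ} {ψ : ℝ → Fin q → ℝ}

theorem corrections_of_lt (k : ℕ) (t : ℝ) {j : ℕ} (hj : k < j) :
    corrections S z a B ψ k t j = 0 := by
  induction k with
  | zero => exact Pi.single_eq_of_ne (M := fun _ => Fin q → ℝ) (by omega) _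
  | succ k ih =>
    rw [corrections, Function.update_of_ne (by omega)]
    exact ih (by omega)

theorem corrections_of_le (k : ℕ) (t : ℝ) {j : ℕ} (hj : j ≤ k) :
    corrections S z a B ψ k t j = corrections S z a B ψ j t j := by
  induction k with
  | zero => rw [Nat.le_zero.1 hj]
  | succ k ih =>
    rcases Nat.lt_or_eq_of_le hj with h | rfl
    · rw [corrections, Function.update_of_ne (by omega), ih (by omega)]
    · rfl

theorem correctedLine_zero : correctedLine z a B 0 (0 : Jet q) = z := by
  funext j
  cases j <;> simp [correctedLine]

theorem hasDerivAt_correctedLine {β : ℝ → Jet q} {t : ℝ}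
    (hβ : ∀ j s, DifferentiableAt ℝ (fun t => β t j s) t) (j : ℕ) (k : Fin n) :
    HasDerivAt (fun t => correctedLine z a B t (β t) j k)
      (a j k + j.casesOn 0 fun j => (B *ᵥ fun s => deriv (fun t => β t j s) t) k) t := by
  have h1 : HasDerivAt (fun t : ℝ => z j k + t * a j k) (a j k) t := by
    simpa using ((hasDerivAt_id t).mul_const (a j k)).const_add (z j k)
  cases j with
  | zero => exact h1.add (hasDerivAt_const t 0)
  | succ j =>
    refine h1.add ?_
    simp only [Matrix.mulVec, dotProduct]
    exact HasDerivAt.fun_sum fun s _ => (hβ j s).hasDerivAt.const_mul _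

/-- At `t = 0` nothing needs correcting since `z` satisfies every equation. Each new correction is
built from an inverse matrix and an analytic function evaluated on the previous stage, hence is
again differentiable. -/
theorem corrections_zero_and_differentiableAt (hz : z ∈ S.locus) (hB : IsUnit (S.leading z * B))
    (h0 : ψ 0 = 0) (hψ : DifferentiableAt ℝ ψ 0) (k : ℕ) :
    corrections S z a B ψ k 0 = 0 ∧
      ∀ j s, DifferentiableAt ℝ (fun t => corrections S z a B ψ k t j s) 0 := by
  induction k with
  | zero =>
    refine ⟨by simp [corrections, h0], fun j s => ?_⟩
    cases j with
    | zero => simpa [corrections] using differentiableAt_pi.1 hψ s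
    | succ j => simp [corrections]
  | succ k ih =>
    obtain ⟨ih0, ih1⟩ := ih
    have hu0 : correctedLine z a B 0 (corrections S z a B ψ k 0) = z := by
      rw [ih0, correctedLine_zero]
    have hcomp {f : Jet n → ℝ} (hf : AnalyticNear f z) : DifferentiableAt ℝ
        (fun t => f (correctedLine z a B t (corrections S z a B ψ k t))) 0 :=
      (AnalyticNear.hasDerivAt_comp
        (γ := fun t => correctedLine z a B t (corrections S z a B ψ k t))
        (by rwa [hu0]) (hasDerivAt_correctedLine ih1)).differentiableAt
    refine ⟨?_, fun j s => ?_⟩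
    · rw [corrections, ih0, correctedLine_zero]
      have : (fun i => cartan^[k + 1] (S.eqn i) z) = 0 := funext fun i => hz.2 _ i
      rw [this, Matrix.mulVec_zero, neg_zero]
      exact Function.update_eq_self (k + 1) (0 : Jet q)
    · by_cases hj : j = k + 1
      · subst hj
        simp only [corrections, Function.update_self, Pi.neg_apply, Matrix.mulVec, dotProduct]
        refine DifferentiableAt.neg (DifferentiableAt.fun_sum fun i _ => DifferentiableAt.mul ?_ ?_)
        · refine DifferentiableAt.matrix_inv (fun i j => ?_) (by rwa [hu0]) s i
          simp only [Matrix.mul_apply]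
          exact DifferentiableAt.fun_sum fun l _ =>
            (hcomp ((S.eqn_mem hz.1 i).pderiv 1 l)).mul_const _
        · exact hcomp ((S.eqn_mem hz.1 i).cartan_iterate (k + 1))
      · simp only [corrections, Function.update_of_ne hj]
        exact ih1 j s

/-- Consecutive stages agree up to order `k + 1`; the affine formula then shows that the last
correction cancels the error of the previous stage. -/
theorem cartan_iterate_eqn_corrections {t : ℝ} {k : ℕ}
    (hdom : (correctedLine z a B t (corrections S z a B ψ k t) 0,
      correctedLine z a B t (corrections S z a B ψ k t) 1) ∈ S.dom)
    (hu : IsUnit (S.leading (correctedLine z a B t (corrections S z a B ψ k t)) * B)) (i : Fin q) :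
    cartan^[k + 1] (S.eqn i) (correctedLine z a B t (corrections S z a B ψ (k + 1) t)) = 0 := by
  set u := correctedLine z a B t (corrections S z a B ψ k t) with hu_def
  have h := cartan_iterate_eqn_add k i (u := u)
    (δ := correctedLine z a B t (corrections S z a B ψ (k + 1) t) - u) hdom (by
      intro j hj
      cases j with
      | zero => simp [u, correctedLine]
      | succ j =>
        simp only [u, Pi.sub_apply, correctedLine]
        rw [corrections_of_le (k + 1) t (j := j) (by omega), corrections_of_le k t (j := j)
          (by omega), sub_self])
  rw [add_sub_cancel] at h
  rw [h]
  have h2 : (correctedLine z a B t (corrections S z a B ψ (k + 1) t) - u) (k + 2) =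
      B *ᵥ (-((S.leading u * B)⁻¹ *ᵥ fun i => cartan^[k + 1] (S.eqn i) u)) := by
    rw [hu_def]
    simp only [Pi.sub_apply, correctedLine]
    rw [corrections_of_lt k t (by omega), Matrix.mulVec_zero, add_zero, add_sub_cancel_left]
    simp only [corrections, Function.update_self]
  rw [h2, Matrix.mulVec_mulVec, Matrix.mulVec_neg, Matrix.mulVec_mulVec, Matrix.mul_nonsing_inv _
    ((Matrix.isUnit_iff_isUnit_det _).1 hu), Matrix.one_mulVec]
  simp

end

/-- Through a regular point of the locus there are curves in the locus whose velocities are arbitrary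
modulo the range of `B` at the orders `≥ 1` and arbitrary at the order `0`. -/
theorem exists_curve_mem_locus {z : Jet n} (hz : z ∈ S.locus) {B : Matrix (Fin n) (Fin q) ℝ}
    (hB : IsUnit (S.leading z * B)) (a : Jet n) :
    ∃ (γ : ℝ → Jet n) (v : Jet n) (b : ℕ → Fin q → ℝ), γ 0 = z ∧
      (∀ j k, HasDerivAt (fun t => γ t j k) (v j k) 0) ∧ v 0 = a 0 ∧
      (∀ j, v (j + 1) = a (j + 1) + B *ᵥ b j) ∧ ∀ᶠ t in 𝓝 0, γ t ∈ S.locus := by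
  obtain ⟨ψ, h0, hψ, hF⟩ := exists_implicit_curve hz hB a
  -- The diagonal collects the final values: entry `j` is fixed at stage `j` and unchanged
  -- afterwards.
  let β : ℝ → Jet q := fun t j => corrections S z a B ψ j t j
  let γ : ℝ → Jet n := fun t => correctedLine z a B t (β t)
  have hcorr := corrections_zero_and_differentiableAt (a := a) hz hB h0 hψ
  have hβ0 : β 0 = 0 := funext fun j => congrFun (hcorr j).1 j
  have hγ0 : γ 0 = z := by
    change correctedLine z a B 0 (β 0) = z
    rw [hβ0, correctedLine_zero]
  have hγ (j k) := hasDerivAt_correctedLine (z := z) (a := a) (B := B) (β := β) (t := 0)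
    (fun j s => (hcorr j).2 j s) j k
  refine ⟨γ, _, fun j s => deriv (fun t => β t j s) 0, hγ0, hγ, ?_, fun j => rfl, ?_⟩
  · funext k
    exact add_zero _
  · have hc : ContinuousAt γ 0 :=
      continuousAt_pi.2 fun j => continuousAt_pi.2 fun k => (hγ j k).continuousAt
    have hunit := eventually_isUnit_leading_mul hz.1 hB
    rw [← hγ0] at hunit
    have hdom : ∀ᶠ w in 𝓝 (γ 0), (w 0, w 1) ∈ S.dom := by
      rw [hγ0]
      exact eventually_mem_dom hz.1
    -- One neighborhood of `t = 0` serves all `k` at once: the domain and the leading matrix depend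
    -- only on the orders `0` and `1`, which are the same at every stage.
    filter_upwards [hF, hc.eventually hunit, hc.eventually hdom] with t h1 h2 h3
    refine ⟨h3, fun k i => ?_⟩
    cases k with
    | zero =>
      refine Eq.trans ?_ (congrFun h1 i)
      change S.F (γ t 0, γ t 1) i = _
      refine congrArg (fun x => S.F x i) (Prod.ext ?_ ?_)
      · exact add_zero _
      · change z 1 + t • a 1 + B *ᵥ (Pi.single 0 (ψ t) : Jet q) 0 = _
        rw [Pi.single_eq_same]
    | succ k =>
      have hagree (l j : ℕ) (hj : j ≤ l + 1) :
          correctedLine z a B t (corrections S z a B ψ l t) j = γ t j := by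
        cases j with
        | zero => rfl
        | succ j =>
          simp only [γ, β, correctedLine]
          rw [corrections_of_le l t (by omega)]
      rw [← cartan_iterate_eqn_congr (k + 1) i h3 (hagree (k + 1))]
      refine cartan_iterate_eqn_corrections ?_ ?_ i
      · rwa [hagree k 0 (by omega), hagree k 1 (by omega)]
      · rwa [leading_congr h3 (hagree k 0 (by omega)) (hagree k 1 (by omega))]

end ImplicitSystem

/-! ### Pairing of operators with jets of velocities. -/

theorem DiffOp.induction_on_terms {K : Type*} [CommRing K] [Differential K]
    {motive : DiffOp K → Prop} (x : DiffOp K) (add : ∀ x y, motive x → motive y → motive (x + y))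
    (term : ∀ a i, motive (C a * D ^ i)) : motive x := by
  have h : ∀ p : K[X], motive (ofPoly p) := by
    intro p
    induction p using Polynomial.induction_on' with
    | add p q hp hq => rw [map_add]; exact add _ _ hp hq
    | monomial i a =>
      rw [← Polynomial.C_mul_X_pow_eq_monomial, ← C_mul_eq, ← D_pow_eq]
      exact term a i
  exact h x

/-- The value `∑ aⱼ(z) uⱼ` of the operator `∑ aⱼ (d/dt)ʲ` on the formal derivatives `uⱼ`, when the
coefficients are evaluated by `ev`. -/
def DiffOp.pairing {K : Type*} [CommRing K] [Differential K] (ev : K →+* ℝ) (u : ℕ → ℝ) :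
    DiffOp K →+ ℝ :=
  AddMonoidHom.mk' (fun x => ((ofPoly (K := K)).symm x).sum fun j a => ev a * u j) fun x y => by
    rw [map_add]
    exact Polynomial.sum_add_index _ _ _ (fun i => by simp) fun i a b => by rw [map_add, add_mul]

theorem DiffOp.pairing_eq_sum {K : Type*} [CommRing K] [Differential K] (ev : K →+* ℝ) (u : ℕ → ℝ)
    {x : DiffOp K} {d : ℕ} (hx : ∀ j ≥ d, coeff j x = 0) :
    pairing ev u x = ∑ j ∈ Finset.range d, ev (coeff j x) * u j := by
  change ((ofPoly (K := K)).symm x).sum (fun j a => ev a * u j) = _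
  rw [Polynomial.sum_def]
  refine Finset.sum_subset (fun j hj => ?_) fun j _ hj => ?_
  · by_contra h
    exact Polynomial.mem_support_iff.1 hj (hx j (by simpa using h))
  · rw [Polynomial.notMem_support_iff.1 hj, map_zero, zero_mul]

theorem DiffOp.pairing_C_mul {K : Type*} [CommRing K] [Differential K] (ev : K →+* ℝ) (u : ℕ → ℝ)
    (a : K) (x : DiffOp K) : pairing ev u (C a * x) = ev a * pairing ev u x := by
  obtain ⟨d, hd⟩ := exists_forall_ge_coeff_eq_zero x
  rw [pairing_eq_sum ev u hd, pairing_eq_sum ev u (d := d), Finset.mul_sum]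
  · refine Finset.sum_congr rfl fun j _ => ?_
    rw [coeff_C_mul, map_mul, mul_assoc]
  · intro j hj
    rw [coeff_C_mul, hd j hj, mul_zero]

/-! ### Rings of analytic functions along a filter: units, evaluation, restriction. -/

namespace Jet

variable {n m p : ℕ} {L : Filter (Jet n)}

theorem mem_analyticSubring {f : Jet n → ℝ} :
    f ∈ analyticSubring L ↔ ∀ᶠ z in L, AnalyticNear f z := Iff.rfl

open Classical in
/-- The element of the function ring along `L` defined by a function analytic along `L` (and `0` for
the other functions). -/
def toFn (L : Filter (Jet n)) (f : Jet n → ℝ) : FnRing L :=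
  if h : f ∈ analyticSubring L then FnRing.mk L ⟨f, h⟩ else 0

theorem toFn_of_mem {f : Jet n → ℝ} (h : f ∈ analyticSubring L) :
    toFn L f = FnRing.mk L ⟨f, h⟩ := dif_pos h

theorem FnRing.exists_toFn_eq (a : FnRing L) : ∃ f ∈ analyticSubring L, toFn L f = a := by
  obtain ⟨⟨f, hf⟩, rfl⟩ := FnRing.mk_surjective a
  exact ⟨f, hf, toFn_of_mem hf⟩

theorem toFn_congr {f g : Jet n → ℝ} (h : ∀ᶠ z in L, f =ᶠ[𝓝 z] g) : toFn L f = toFn L g := by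
  by_cases hf : f ∈ analyticSubring L
  · have hg : g ∈ analyticSubring L := by
      filter_upwards [h, mem_analyticSubring.1 hf] with z h1 h2 using h2.congr h1
    rw [toFn_of_mem hf, toFn_of_mem hg]
    exact FnRing.mk_eq_mk h
  · have hg : g ∉ analyticSubring L := fun hg => hf (by
      filter_upwards [h, mem_analyticSubring.1 hg] with z h1 h2 using h2.congr h1.symm)
    rw [toFn, dif_neg hf, toFn, dif_neg hg]

theorem toFn_mul {f g : Jet n → ℝ} (hf : f ∈ analyticSubring L) (hg : g ∈ analyticSubring L) :
    toFn L (f * g) = toFn L f * toFn L g := by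
  rw [toFn_of_mem hf, toFn_of_mem hg, toFn_of_mem (mul_mem hf hg), ← map_mul]
  rfl

theorem toFn_one : toFn L 1 = 1 := by
  rw [toFn_of_mem (one_mem _)]
  exact map_one _

theorem toFn_sum {ι : Type*} (s : Finset ι) {f : ι → Jet n → ℝ}
    (hf : ∀ i ∈ s, f i ∈ analyticSubring L) :
    toFn L (∑ i ∈ s, f i) = ∑ i ∈ s, toFn L (f i) := by
  classical
  rw [toFn_of_mem (sum_mem hf)]
  have h : (⟨∑ i ∈ s, f i, sum_mem hf⟩ : analyticSubring L) =
      ∑ i : s, ⟨f i, hf i i.2⟩ := by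
    refine Subtype.ext ?_
    rw [AddSubmonoidClass.coe_finsetSum]
    exact (Finset.sum_coe_sort s f).symm
  rw [h, map_sum, ← Finset.sum_coe_sort s fun i => toFn L (f i)]
  exact Finset.sum_congr rfl fun i _ => (toFn_of_mem (hf i i.2)).symm

theorem deriv_toFn {f : Jet n → ℝ} (hf : f ∈ analyticSubring L) :
    (toFn L f)′ = toFn L (cartan f) := by
  rw [toFn_of_mem hf, FnRing.deriv_mk, toFn_of_mem]

theorem const_mem_analyticSubring (c : ℝ) : (fun _ : Jet n => c) ∈ analyticSubring L :=
  Eventually.of_forall fun z => analyticNear_const c z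

theorem toFn_zero : toFn L (fun _ => 0) = 0 := by
  rw [toFn_of_mem (const_mem_analyticSubring 0)]
  exact map_zero (FnRing.mk L)

theorem deriv_toFn_const (c : ℝ) : (toFn L fun _ => c)′ = 0 := by
  rw [deriv_toFn (const_mem_analyticSubring c), cartan_const]
  exact toFn_zero

theorem AnalyticNear.inv {f : Jet n → ℝ} {z : Jet n} (hf : AnalyticNear f z) (h0 : f z ≠ 0) :
    AnalyticNear f⁻¹ z := by
  obtain ⟨r, g, hg, hfg⟩ := hf
  refine ⟨r, g⁻¹, hg.inv ?_, hfg.inv⟩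
  rwa [← hfg.eq_of_nhds]

theorem isUnit_mk {f : analyticSubring L} (h0 : ∀ᶠ z in L, (f : Jet n → ℝ) z ≠ 0) :
    IsUnit (FnRing.mk L f) := by
  have hf : ∀ᶠ z in L, AnalyticNear (f : Jet n → ℝ) z := f.2
  have hinv : (f : Jet n → ℝ)⁻¹ ∈ analyticSubring L := by
    filter_upwards [hf, h0] with z h1 h2 using h1.inv h2
  refine IsUnit.of_mul_eq_one (FnRing.mk L ⟨_, hinv⟩) ?_
  rw [← map_mul, ← map_one (FnRing.mk L)]
  refine FnRing.mk_eq_mk ?_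
  filter_upwards [hf, h0] with z h1 h2
  filter_upwards [h1.continuousAt.eventually_ne h2] with w hw
  exact mul_inv_cancel₀ hw

theorem isUnit_toFn_matrix {q : ℕ} {M : Jet n → Matrix (Fin q) (Fin q) ℝ}
    (hM : ∀ i j, (fun z => M z i j) ∈ analyticSubring L) (hu : ∀ᶠ z in L, IsUnit (M z)) :
    IsUnit (Matrix.of fun i j => toFn L fun z => M z i j) := by
  rw [Matrix.isUnit_iff_isUnit_det]
  let N : Matrix (Fin q) (Fin q) (analyticSubring L) := Matrix.of fun i j => ⟨_, hM i j⟩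
  have hN : (Matrix.of fun i j => toFn L fun z => M z i j) = (FnRing.mk L).mapMatrix N := by
    ext i j
    exact toFn_of_mem (hM i j)
  rw [hN, ← RingHom.map_det]
  refine isUnit_mk ?_
  filter_upwards [hu] with z hz
  have h : ((N.det : analyticSubring L) : Jet n → ℝ) z = (M z).det := by
    change ((Pi.evalRingHom (fun _ : Jet n => ℝ) z).comp (analyticSubring L).subtype) N.det = _
    rw [RingHom.map_det]
    rfl
  rw [h]
  exact ((Matrix.isUnit_iff_isUnit_det _).1 hz).ne_zero

/-- Evaluation at a point of `L`. -/
def FnRing.eval {z : Jet n} (hz : pure z ≤ L) : FnRing L →+* ℝ :=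
  Ideal.Quotient.lift (vanishingIdeal L)
    ((Pi.evalRingHom (fun _ : Jet n => ℝ) z).comp (analyticSubring L).subtype)
    fun _ hf => (hf 0).filter_mono hz

theorem FnRing.eval_toFn {z : Jet n} (hz : pure z ≤ L) {f : Jet n → ℝ}
    (hf : f ∈ analyticSubring L) : FnRing.eval hz (toFn L f) = f z := by
  rw [toFn_of_mem hf]
  rfl

/-- Restriction of functions to a smaller filter. -/
def FnRing.restrict {L' : Filter (Jet n)} (h : L' ≤ L) : FnRing L →+* FnRing L' :=
  Ideal.Quotient.lift (vanishingIdeal L)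
    ((FnRing.mk L').comp (Subring.inclusion fun _ hf => hf.filter_mono h))
    fun _ hf => FnRing.mk_eq_zero.2 fun k => (hf k).filter_mono h

theorem FnRing.restrict_toFn {L' : Filter (Jet n)} (h : L' ≤ L) {f : Jet n → ℝ}
    (hf : f ∈ analyticSubring L) : FnRing.restrict h (toFn L f) = toFn L' f := by
  rw [toFn_of_mem hf, toFn_of_mem (hf.filter_mono h)]
  rfl

theorem FnRing.restrict_deriv {L' : Filter (Jet n)} (h : L' ≤ L) (a : FnRing L) :
    FnRing.restrict h (a′) = (FnRing.restrict h a)′ := by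
  obtain ⟨f, rfl⟩ := FnRing.mk_surjective a
  rfl

/-- The Cartan field is tangent to the set `Λ` at the points of `N`. -/
def CartanTangentOn (Λ N : Set (Jet n)) : Prop :=
  ∀ z ∈ N ∩ Λ, ∀ h : Jet n → ℝ, AnalyticNear h z → (∀ᶠ w in 𝓝[Λ] z, h w = 0) → cartan h z = 0

/-- Being zero in the ring asks that all Cartan derivatives vanish on the set; tangency passes the
vanishing from each derivative to the next. -/
theorem toFn_eq_of_eqOn {Λ N : Set (Jet n)} (hN : IsOpen N) (htan : CartanTangentOn Λ N)
    {f g : Jet n → ℝ} (hf : f ∈ analyticSubring (𝓟 N ⊓ 𝓟 Λ))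
    (hg : g ∈ analyticSubring (𝓟 N ⊓ 𝓟 Λ)) (h : Set.EqOn f g (N ∩ Λ)) :
    toFn (𝓟 N ⊓ 𝓟 Λ) f = toFn (𝓟 N ⊓ 𝓟 Λ) g := by
  rw [toFn_of_mem hf, toFn_of_mem hg, ← sub_eq_zero, ← map_sub, FnRing.mk_eq_zero]
  set e : analyticSubring (𝓟 N ⊓ 𝓟 Λ) := ⟨f, hf⟩ - ⟨g, hg⟩ with he
  have hmem (P : Jet n → Prop) : (∀ᶠ z in 𝓟 N ⊓ 𝓟 Λ, P z) ↔ ∀ z ∈ N ∩ Λ, P z := by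
    rw [inf_principal, eventually_principal]
  have hean := (hmem _).1 (mem_analyticSubring.1 e.2)
  intro k
  rw [hmem]
  induction k with
  | zero =>
    intro z hz
    change f z - g z = 0
    rw [h hz, sub_self]
  | succ k ih =>
    intro z hz
    rw [Function.iterate_succ_apply']
    refine htan z hz _ ((hean z hz).cartan_iterate k) ?_
    filter_upwards [self_mem_nhdsWithin, mem_nhdsWithin_of_mem_nhds (hN.mem_nhds hz.1)]
      with w h1 h2 using ih w ⟨h2, h1⟩

/-! ### Differentials as rows of operators, and the chain rule. -/

/-- The operators `w` are the components of the differential of `g`, taken along `prolong θ`: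
`wₖ = ∑ (∂g/∂xₖ⁽ʲ⁾ ∘ prolong θ) (d/dt)ʲ`. -/
def IsDiffAlong (L : Filter (Jet n)) (θ : Fin p → Jet n → ℝ) (g : Jet p → ℝ)
    (w : Fin p → DiffOp (FnRing L)) : Prop :=
  ∀ j k, DiffOp.coeff j (w k) = toFn L fun z => pderiv g j k (prolong θ z)

/-- The components of order less than `r` of the differential of `g` along the map `Θ`. -/
def rowOp (L : Filter (Jet n)) (r : ℕ) (g : Jet p → ℝ) (Θ : Jet n → Jet p) (k : Fin p) :
    DiffOp (FnRing L) :=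
  ∑ j ∈ Finset.range r, DiffOp.C (toFn L fun z => pderiv g j k (Θ z)) * DiffOp.D ^ j

theorem lineDeriv_congr {f g : Jet n → ℝ} {z : Jet n} (h : f =ᶠ[𝓝 z] g) (v : Jet n) :
    lineDeriv ℝ f z v = lineDeriv ℝ g z v := by
  have hc : Tendsto (fun t : ℝ => z + t • v) (𝓝 0) (𝓝 z) := by
    have : Continuous fun t : ℝ => z + t • v := by fun_prop
    simpa using this.tendsto 0
  exact Filter.EventuallyEq.deriv_eq (hc.eventually h)

theorem eventually_nhds_analyticNear {θ : Fin p → Jet n → ℝ}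
    (hθ : ∀ᶠ z in L, ∀ i, AnalyticNear (θ i) z) {P : Jet p → Prop}
    (hP : ∀ᶠ z in L, ∀ᶠ y in 𝓝 (prolong θ z), P y) :
    ∀ᶠ z in L, ∀ᶠ w in 𝓝 z, (∀ i, AnalyticNear (θ i) w) ∧ P (prolong θ w) := by
  filter_upwards [hθ, hP] with z h1 h2
  exact (eventually_all.2 fun i => (h1 i).eventually).and ((continuousAt_prolong h1).eventually h2)

theorem comp_prolong_mem {θ : Fin p → Jet n → ℝ} (hθ : ∀ᶠ z in L, ∀ i, AnalyticNear (θ i) z)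
    {g : Jet p → ℝ} (hg : ∀ᶠ z in L, AnalyticNear g (prolong θ z)) :
    (fun z => g (prolong θ z)) ∈ analyticSubring L := by
  filter_upwards [hθ, hg] with z h1 h2 using h2.comp_prolong h1

/-- Partial derivatives depend on the germ in the full jet space, so agreement is required on whole
neighborhoods of `prolong θ z`; agreement on a locus would not do. -/
theorem IsDiffAlong.eq_of_eventuallyEq {θ : Fin p → Jet n → ℝ}
    (hθ : ∀ᶠ z in L, ∀ i, AnalyticNear (θ i) z) {g g' : Jet p → ℝ} {w w' : Fin p → DiffOp (FnRing L)}
    (h : IsDiffAlong L θ g w) (h' : IsDiffAlong L θ g' w')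
    (hgg' : ∀ᶠ z in L, g =ᶠ[𝓝 (prolong θ z)] g') : w = w' := by
  funext k
  refine DiffOp.ext_coeff fun j => ?_
  rw [h, h']
  refine toFn_congr ?_
  have := eventually_nhds_analyticNear hθ (P := fun y => pderiv g j k y = pderiv g' j k y) (by
    filter_upwards [hgg'] with z hz
    filter_upwards [hz.eventually_nhds] with y hy
    exact lineDeriv_congr hy _)
  filter_upwards [this] with z hz
  filter_upwards [hz] with w hw using hw.2

theorem coeff_rowOp {r : ℕ} {g : Jet p → ℝ} {Θ : Jet n → Jet p} (j : ℕ) (k : Fin p) :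
    DiffOp.coeff j (rowOp L r g Θ k) = if j < r then toFn L fun z => pderiv g j k (Θ z) else 0 := by
  rw [rowOp, map_sum]
  simp only [DiffOp.coeff_C_mul_D_pow, Finset.sum_ite_eq, Finset.mem_range]

theorem isDiffAlong_rowOp {θ : Fin p → Jet n → ℝ} (hθ : ∀ᶠ z in L, ∀ i, AnalyticNear (θ i) z)
    {r : ℕ} {g : Jet p → ℝ} (hg : ∀ᶠ z in L, OrderLE r g (prolong θ z)) :
    IsDiffAlong L θ g (rowOp L r g (prolong θ)) := by
  intro j k
  rw [coeff_rowOp]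
  split_ifs with hj
  · rfl
  · rw [← toFn_zero]
    refine toFn_congr ?_
    filter_upwards [eventually_nhds_analyticNear hθ (hg.mono fun z hz => hz.eventually)] with z hz
    filter_upwards [hz] with w hw
    exact (hw.2.pderiv_eq_zero (not_lt.1 hj) k).symm

theorem IsDiffAlong.sub {θ : Fin p → Jet n → ℝ} (hθ : ∀ᶠ z in L, ∀ i, AnalyticNear (θ i) z)
    {g g' : Jet p → ℝ} {w w' : Fin p → DiffOp (FnRing L)}
    (h : IsDiffAlong L θ g w) (h' : IsDiffAlong L θ g' w')
    (hg : ∀ᶠ z in L, AnalyticNear g (prolong θ z)) (hg' : ∀ᶠ z in L, AnalyticNear g' (prolong θ z)) :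
    IsDiffAlong L θ (g - g') (w - w') := by
  intro j k
  have h1 := comp_prolong_mem hθ (hg.mono fun z hz => hz.pderiv j k)
  have h2 := comp_prolong_mem hθ (hg'.mono fun z hz => hz.pderiv j k)
  rw [Pi.sub_apply, map_sub, h, h', toFn_of_mem h1, toFn_of_mem h2, ← map_sub]
  refine Eq.trans ?_ (toFn_congr (f := (fun z => pderiv g j k (prolong θ z)) - fun z =>
    pderiv g' j k (prolong θ z)) ?_)
  · rw [toFn_of_mem (sub_mem h1 h2)]
    rfl
  · filter_upwards [eventually_nhds_analyticNear hθ (hg.mono fun z hz => hz.eventually),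
      eventually_nhds_analyticNear hθ (hg'.mono fun z hz => hz.eventually)] with z hz hz'
    filter_upwards [hz, hz'] with w hw hw'
    exact (HasDerivAt.sub (hw.2.hasLineDerivAt _) (hw'.2.hasLineDerivAt _)).deriv.symm

/-- The coefficients of `D • w` obey the commutation rule of the partial derivatives with `d/dt`,
and `d/dt` commutes with composition by a prolongation. -/
theorem IsDiffAlong.cartan {θ : Fin p → Jet n → ℝ} (hθ : ∀ᶠ z in L, ∀ i, AnalyticNear (θ i) z)
    {g : Jet p → ℝ} {w : Fin p → DiffOp (FnRing L)} (h : IsDiffAlong L θ g w)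
    (hg : ∀ᶠ z in L, AnalyticNear g (prolong θ z)) :
    IsDiffAlong L θ (Jet.cartan g) ((DiffOp.D : DiffOp (FnRing L)) • w) := by
  intro j k
  have hmem (j) := comp_prolong_mem hθ (hg.mono fun z hz => hz.pderiv j k)
  have hev := eventually_nhds_analyticNear hθ (hg.mono fun z hz => hz.eventually)
  rw [Pi.smul_apply, smul_eq_mul]
  cases j with
  | zero =>
    rw [DiffOp.coeff_zero_D_mul, h, deriv_toFn (hmem 0)]
    refine toFn_congr ?_
    filter_upwards [hev] with z hz
    filter_upwards [hz] with w hw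
    rw [(hw.2.pderiv 0 k).cartan_comp_prolong hw.1, hw.2.pderiv_zero_cartan]
  | succ j =>
    rw [DiffOp.coeff_succ_D_mul, h, h, deriv_toFn (hmem (j + 1)), toFn_of_mem (hmem j),
      toFn_of_mem (cartan_mem ⟨_, hmem (j + 1)⟩), ← map_add]
    refine Eq.trans ?_ (toFn_congr (f := (fun z => pderiv g j k (prolong θ z)) +
      Jet.cartan fun z => pderiv g (j + 1) k (prolong θ z)) ?_)
    · rw [toFn_of_mem (add_mem (hmem j) (cartan_mem ⟨_, hmem (j + 1)⟩))]
      rfl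
    · filter_upwards [hev] with z hz
      filter_upwards [hz] with w hw
      rw [Pi.add_apply, (hw.2.pderiv (j + 1) k).cartan_comp_prolong hw.1, hw.2.pderiv_succ_cartan]

theorem IsDiffAlong.cartan_iterate {θ : Fin p → Jet n → ℝ}
    (hθ : ∀ᶠ z in L, ∀ i, AnalyticNear (θ i) z)
    {g : Jet p → ℝ} {w : Fin p → DiffOp (FnRing L)} (h : IsDiffAlong L θ g w)
    (hg : ∀ᶠ z in L, AnalyticNear g (prolong θ z)) (l : ℕ) :
    IsDiffAlong L θ (Jet.cartan^[l] g) ((DiffOp.D : DiffOp (FnRing L)) ^ l • w) := by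
  induction l with
  | zero => simpa using h
  | succ l ih =>
    rw [Function.iterate_succ_apply', pow_succ', mul_smul]
    exact ih.cartan hθ (hg.mono fun z hz => hz.cartan_iterate l)

/-- The chain rule: the differential of `g ∘ prolong φ` is the product of the differential of `g` and
of the matrix of the differentials of the components of `φ`. -/
theorem IsDiffAlong.comp_prolong {θ : Fin p → Jet n → ℝ}
    (hθ : ∀ᶠ z in L, ∀ i, AnalyticNear (θ i) z) {φ : Fin m → Jet p → ℝ}
    (hφ : ∀ᶠ z in L, ∀ i, AnalyticNear (φ i) (prolong θ z)) {r : ℕ} {g : Jet m → ℝ}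
    (hg : ∀ᶠ z in L, OrderLE r g (prolong φ (prolong θ z)))
    {Q : Matrix (Fin m) (Fin p) (DiffOp (FnRing L))} (hQ : ∀ i, IsDiffAlong L θ (φ i) (Q i)) :
    IsDiffAlong L θ (fun y => g (prolong φ y))
      (Matrix.vecMul (rowOp L r g fun z => prolong φ (prolong θ z)) Q) := by
  intro l k
  have hφ' (i) : ∀ᶠ z in L, AnalyticNear (φ i) (prolong θ z) := hφ.mono fun z hz => hz i
  have hev : ∀ᶠ z in L, ∀ᶠ y in 𝓝 (prolong θ z),
      (∀ i, AnalyticNear (φ i) y) ∧ OrderLE r g (prolong φ y) := by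
    filter_upwards [hφ, hg] with z h1 h2
    exact (eventually_all.2 fun i => (h1 i).eventually).and
      ((continuousAt_prolong h1).eventually h2.eventually)
  have hmem1 (j i) : (fun z => pderiv g j i (prolong φ (prolong θ z))) ∈ analyticSubring L := by
    refine comp_prolong_mem hθ (g := fun y => pderiv g j i (prolong φ y)) ?_
    filter_upwards [hφ, hg] with z h1 h2 using (h2.analyticNear.pderiv j i).comp_prolong h1
  have hmem2 (j i) : (fun z => pderiv (Jet.cartan^[j] (φ i)) l k (prolong θ z)) ∈
      analyticSubring L :=
    comp_prolong_mem hθ ((hφ' i).mono fun z hz => (hz.cartan_iterate j).pderiv l k)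
  rw [Matrix.vecMul, dotProduct, map_sum]
  have hterm (i) : DiffOp.coeff l (rowOp L r g (fun z => prolong φ (prolong θ z)) i * Q i k) =
      toFn L (∑ j ∈ Finset.range r, (fun z => pderiv g j i (prolong φ (prolong θ z))) *
        fun z => pderiv (Jet.cartan^[j] (φ i)) l k (prolong θ z)) := by
    rw [rowOp, Finset.sum_mul, map_sum, toFn_sum _ fun j _ => mul_mem (hmem1 j i) (hmem2 j i)]
    refine Finset.sum_congr rfl fun j _ => ?_
    rw [toFn_mul (hmem1 j i) (hmem2 j i), mul_assoc, DiffOp.coeff_C_mul]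
    congr 1
    -- The row `Dʲ • Q i` is the differential of the `j`-th Cartan derivative of `φ i`, the
    -- component `(j, i)` of `prolong φ`.
    exact (hQ i).cartan_iterate hθ (hφ' i) j l k
  simp only [hterm]
  rw [← toFn_sum _ fun i _ => sum_mem fun j _ => mul_mem (hmem1 j i) (hmem2 j i)]
  refine toFn_congr ?_
  filter_upwards [eventually_nhds_analyticNear hθ hev] with z hz
  filter_upwards [hz] with w hw
  simp only [Finset.sum_apply, Pi.mul_apply]
  rw [Finset.sum_comm]
  refine Eq.trans ?_ (hw.2.2.analyticNear.lineDeriv_comp_prolong hw.2.1 _).symm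
  rw [hw.2.2.lineDeriv_eq_sum]
  rfl

theorem analyticNear_coord (j : ℕ) (i : Fin n) (z : Jet n) : AnalyticNear (coord j i) z :=
  (orderLE_coord j i z).analyticNear

theorem isDiffAlong_coord_zero {θ : Fin p → Jet n → ℝ} (i : Fin p) :
    IsDiffAlong L θ (coord 0 i) (Pi.single i 1) := by
  intro j k
  simp only [pderiv_coord]
  by_cases h : j = 0 ∧ k = i
  · obtain ⟨rfl, rfl⟩ := h
    simp only [Pi.single_eq_same, and_self, if_true]
    rw [← DiffOp.C_one, DiffOp.coeff_C, if_pos rfl]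
    exact toFn_one.symm
  · simp only [if_neg h]
    rw [toFn_zero]
    by_cases hk : k = i
    · subst hk
      rw [Pi.single_eq_same, ← DiffOp.C_one, DiffOp.coeff_C, if_neg fun hj => h ⟨hj, rfl⟩]
    · rw [Pi.single_eq_of_ne hk, map_zero]

theorem pairing_eq_lineDeriv {g : Jet n → ℝ} (hg : g ∈ analyticSubring L)
    {w : Fin n → DiffOp (FnRing L)} (h : IsDiffAlong L (coord 0) g w) {z : Jet n}
    (hz : pure z ≤ L) (v : Jet n) :
    ∑ k, DiffOp.pairing (FnRing.eval hz) (fun j => v j k) (w k) = lineDeriv ℝ g z v := by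
  have hgz : AnalyticNear g z := (mem_analyticSubring.1 hg).filter_mono hz
  obtain ⟨r, hr⟩ := hgz
  choose d hd using fun k => DiffOp.exists_forall_ge_coeff_eq_zero (w k)
  -- A common bound for the order of `g` at `z` and for the orders of the operators, so that both
  -- sides are sums over the same range.
  have hr' : OrderLE (max r (Finset.univ.sup d)) g z := OrderLE.mono hr (le_max_left _ _)
  rw [hr'.lineDeriv_eq_sum, Finset.sum_comm]
  refine Finset.sum_congr rfl fun k _ => ?_
  rw [DiffOp.pairing_eq_sum (d := max r (Finset.univ.sup d))]
  · refine Finset.sum_congr rfl fun j _ => ?_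
    have hpd : pderiv g j k ∈ analyticSubring L := hg.mono fun z hz => hz.pderiv j k
    have hjk := h j k
    simp only [prolong_coord] at hjk
    rw [hjk]
    congr 1
    exact FnRing.eval_toFn hz hpd
  · intro j hj
    exact hd k j ((Finset.le_sup (Finset.mem_univ k)).trans ((le_max_right _ _).trans hj))

/-- `a Dⁱ • w` is `a` times the differential of the `i`-th Cartan derivative of `g`, which kills `v`
by hypothesis. -/
theorem pairing_smul_eq_zero {g : Jet n → ℝ} (hg : g ∈ analyticSubring L)
    {w : Fin n → DiffOp (FnRing L)} (h : IsDiffAlong L (coord 0) g w) {z : Jet n}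
    (hz : pure z ≤ L) {v : Jet n} (hv : ∀ l, lineDeriv ℝ (cartan^[l] g) z v = 0)
    (x : DiffOp (FnRing L)) :
    ∑ k, DiffOp.pairing (FnRing.eval hz) (fun j => v j k) ((x • w) k) = 0 := by
  have hθ : ∀ᶠ z in L, ∀ i : Fin n, AnalyticNear (coord 0 i) z :=
    Eventually.of_forall fun z i => analyticNear_coord 0 i z
  have hg' : ∀ᶠ z in L, AnalyticNear g (prolong (coord 0) z) := by
    simp only [prolong_coord]
    exact hg
  induction x using DiffOp.induction_on_terms with
  | add x y hx hy => simp only [add_smul, Pi.add_apply, map_add, Finset.sum_add_distrib, hx, hy,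
      add_zero]
  | term a i =>
    have h1 := pairing_eq_lineDeriv (hg.mono fun z hz => hz.cartan_iterate i)
      (h.cartan_iterate hθ hg' i) hz v
    rw [hv i] at h1
    simp only [mul_smul]
    simp only [Pi.smul_apply (DiffOp.C a), smul_eq_mul, DiffOp.pairing_C_mul]
    rw [← Finset.mul_sum]
    simp only [Pi.smul_apply, smul_eq_mul] at h1 ⊢
    rw [h1, mul_zero]

end Jet

/-! ### Vanishing tests by curves and by values on the locus. -/

namespace Jet

variable {n : ℕ}

theorem AnalyticNear.lineDeriv_eq_zero_of_curve {f : Jet n → ℝ} {γ : ℝ → Jet n} {v z : Jet n}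
    (hz : γ 0 = z) (hf : AnalyticNear f z)
    (hγ : ∀ j k, HasDerivAt (fun t => γ t j k) (v j k) 0) (h : ∀ᶠ t in 𝓝 0, f (γ t) = 0) :
    lineDeriv ℝ f z v = 0 := by
  subst hz
  have h1 := hf.hasDerivAt_comp hγ
  exact h1.unique ((hasDerivAt_const (0 : ℝ) (0 : ℝ)).congr_of_eventuallyEq h)

theorem FnRing.eq_zero_of_eval {Λ N : Set (Jet n)} (hN : IsOpen N) (htan : CartanTangentOn Λ N)
    {a : FnRing (𝓟 N ⊓ 𝓟 Λ)} (ha : ∀ z (hz : pure z ≤ 𝓟 N ⊓ 𝓟 Λ), FnRing.eval hz a = 0) :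
    a = 0 := by
  obtain ⟨f, hf, rfl⟩ := FnRing.exists_toFn_eq a
  rw [← toFn_zero]
  refine toFn_eq_of_eqOn hN htan hf (const_mem_analyticSubring 0) fun z hz => ?_
  have hz' : pure z ≤ 𝓟 N ⊓ 𝓟 Λ := by
    rw [inf_principal, pure_le_principal]
    exact hz
  rw [← FnRing.eval_toFn hz' hf]
  exact ha z hz'

theorem rowOp_congr {p r : ℕ} {Λ N : Set (Jet n)} (hN : IsOpen N) (htan : CartanTangentOn Λ N)
    {g : Jet p → ℝ} {Θ Θ' : Jet n → Jet p}
    (h : ∀ j k, (fun z => pderiv g j k (Θ z)) ∈ analyticSubring (𝓟 N ⊓ 𝓟 Λ))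
    (h' : ∀ j k, (fun z => pderiv g j k (Θ' z)) ∈ analyticSubring (𝓟 N ⊓ 𝓟 Λ))
    (hΘ : Set.EqOn Θ Θ' (N ∩ Λ)) :
    rowOp (𝓟 N ⊓ 𝓟 Λ) r g Θ = rowOp (𝓟 N ⊓ 𝓟 Λ) r g Θ' := by
  funext k
  refine Finset.sum_congr rfl fun j _ => ?_
  rw [toFn_eq_of_eqOn hN htan (h j k) (h' j k) fun z hz => by simp only [hΘ hz]]

end Jet

/-! ### Linearization of a flat chart and the block inverse of `P(F)`. -/

namespace ImplicitSystem

open Jet Matrix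

variable {n q m : ℕ} (S : ImplicitSystem n q)

theorem orderLE_eqn {S : ImplicitSystem n q} {z : Jet n} (hz : (z 0, z 1) ∈ S.dom) (i : Fin q) :
    OrderLE 2 (S.eqn i) z := by
  let c : (Fin 2 → Fin n → ℝ) →L[ℝ] (Fin n → ℝ) × (Fin n → ℝ) :=
    (ContinuousLinearMap.proj 0).prod (ContinuousLinearMap.proj 1)
  refine ⟨fun p => S.F (c p) i, ?_, Eventually.of_forall fun w => rfl⟩
  have h1 : AnalyticAt ℝ S.F (c (trunc 2 z)) := S.analytic _ hz
  have h2 : AnalyticAt ℝ (fun p => S.F (c p)) (trunc 2 z) :=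
    AnalyticAt.fun_comp h1 (c.analyticAt _)
  exact ((ContinuousLinearMap.proj (R := ℝ) (φ := fun _ : Fin q => ℝ) i).analyticAt _).fun_comp h2

/-- Analytic functions `φ`, `f` of bounded order whose prolongations are, on the open set `N`, mutually
inverse parametrizations of the locus of `S` by the jets of `m` independent functions, together with
a constant matrix `B` for which `(∂F/∂ẋ) B` is invertible. -/
structure FlatChart (m : ℕ) (N : Set (Jet n)) where
  φ : Fin n → Jet m → ℝ
  f : Fin m → Jet n → ℝ
  r : ℕ
  s : ℕ
  B : Matrix (Fin n) (Fin q) ℝ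
  isOpen : IsOpen N
  tangent : CartanTangentOn S.locus N
  isUnit_leading : ∀ z ∈ N ∩ S.locus, IsUnit (S.leading z * B)
  orderLE_f : ∀ z ∈ N ∩ S.locus, ∀ k, OrderLE r (f k) z
  orderLE_φ : ∀ z ∈ N ∩ S.locus, ∀ i, OrderLE s (φ i) (prolong f z)
  -- This identity holds on the locus only, while the next two hold on full neighborhoods in the
  -- jets of `ℝᵐ` and can be differentiated directly.
  leftInv : ∀ z ∈ N ∩ S.locus, prolong φ (prolong f z) = z
  rightInv : ∀ z ∈ N ∩ S.locus, ∀ᶠ y in 𝓝 (prolong f z), ∀ k, f k (prolong φ y) = y 0 k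
  mem_locus : ∀ z ∈ N ∩ S.locus, ∀ᶠ y in 𝓝 (prolong f z), prolong φ y ∈ S.locus

/-- The matrix `∂F/∂x + ∂F/∂ẋ d/dt` over the ring of analytic functions along `L`. -/
def analyticPolyMatrix (L : Filter (Jet n)) : Matrix (Fin q) (Fin n) (DiffOp (FnRing L)) :=
  Matrix.of fun i k => DiffOp.C (toFn L (pderiv (S.eqn i) 0 k)) +
    DiffOp.C (toFn L (pderiv (S.eqn i) 1 k)) * DiffOp.D

theorem traceFilter_mono {l l' : Filter (Jet n)} (h : l ≤ l') : S.traceFilter l ≤ S.traceFilter l' :=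
  inf_le_inf_right _ h

namespace FlatChart

variable {S} {N : Set (Jet n)} (c : S.FlatChart m N)

/-- The matrix of the differential of `f`. -/
def matT : Matrix (Fin m) (Fin n) (DiffOp (FnRing (S.traceFilter (𝓟 N)))) :=
  Matrix.of fun k => rowOp _ c.r (c.f k) (prolong (coord 0))

/-- The matrix of the differential of `φ` along `prolong f`. -/
def matQ : Matrix (Fin n) (Fin m) (DiffOp (FnRing (S.traceFilter (𝓟 N)))) :=
  Matrix.of fun i => rowOp _ c.s (c.φ i) (prolong c.f)

theorem eventually_trace {P : Jet n → Prop} :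
    (∀ᶠ z in S.traceFilter (𝓟 N), P z) ↔ ∀ z ∈ N ∩ S.locus, P z := by
  rw [traceFilter, inf_principal, eventually_principal]

theorem eventually_coord {L : Filter (Jet n)} :
    ∀ᶠ z in L, ∀ i : Fin n, AnalyticNear (coord 0 i) z :=
  Eventually.of_forall fun z i => analyticNear_coord 0 i z

theorem eventually_f : ∀ᶠ z in S.traceFilter (𝓟 N), ∀ k, AnalyticNear (c.f k) z :=
  eventually_trace.2 fun z hz k => (c.orderLE_f z hz k).analyticNear

theorem eventually_φ : ∀ᶠ z in S.traceFilter (𝓟 N), ∀ i, AnalyticNear (c.φ i) (prolong c.f z) :=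
  eventually_trace.2 fun z hz k => (c.orderLE_φ z hz k).analyticNear

theorem isDiffAlong_matT (k : Fin m) :
    IsDiffAlong (S.traceFilter (𝓟 N)) (coord 0) (c.f k) (c.matT k) :=
  isDiffAlong_rowOp eventually_coord (eventually_trace.2 fun z hz => by
    rw [prolong_coord]
    exact c.orderLE_f z hz k)

theorem isDiffAlong_matQ (i : Fin n) :
    IsDiffAlong (S.traceFilter (𝓟 N)) c.f (c.φ i) (c.matQ i) :=
  isDiffAlong_rowOp c.eventually_f (eventually_trace.2 fun z hz => c.orderLE_φ z hz i)

theorem analyticPolyMatrix_row (i : Fin q) : S.analyticPolyMatrix (S.traceFilter (𝓟 N)) i =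
    rowOp (S.traceFilter (𝓟 N)) 2 (S.eqn i) (prolong (coord 0)) := by
  funext k
  simp only [rowOp, Finset.sum_range_succ, Finset.sum_range_zero, zero_add, pow_zero, mul_one,
    pow_one, prolong_coord]
  rfl

theorem isDiffAlong_polyMatrix (i : Fin q) : IsDiffAlong (S.traceFilter (𝓟 N)) (coord 0) (S.eqn i)
    (S.analyticPolyMatrix (S.traceFilter (𝓟 N)) i) := by
  rw [analyticPolyMatrix_row]
  refine isDiffAlong_rowOp eventually_coord (eventually_trace.2 fun z hz => ?_)
  rw [prolong_coord]
  exact orderLE_eqn hz.2.1 i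

/-- The chain rule for `g ∘ prolong φ` along `prolong f`, simplified by `prolong φ ∘ prolong f = id`
on the locus. -/
theorem isDiffAlong_comp_prolong {r : ℕ} {g : Jet n → ℝ} (hg : ∀ z ∈ N ∩ S.locus, OrderLE r g z) :
    IsDiffAlong (S.traceFilter (𝓟 N)) c.f (fun y => g (prolong c.φ y))
      (rowOp (S.traceFilter (𝓟 N)) r g (prolong (coord 0)) ᵥ* c.matQ) := by
  have hg' : ∀ᶠ z in S.traceFilter (𝓟 N), OrderLE r g (prolong c.φ (prolong c.f z)) :=
    eventually_trace.2 fun z hz => by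
      rw [c.leftInv z hz]
      exact hg z hz
  -- The chain rule evaluates the coefficients at `prolong φ (prolong f z)`, which is `z` on the
  -- locus; by tangency this suffices for equality in the ring.
  have h : rowOp (S.traceFilter (𝓟 N)) r g (prolong (coord 0)) =
      rowOp (S.traceFilter (𝓟 N)) r g fun z => prolong c.φ (prolong c.f z) := by
    refine rowOp_congr c.isOpen c.tangent (fun j k => ?_) (fun j k => ?_) fun z hz => ?_
    · simp only [prolong_coord]
      exact eventually_trace.2 fun z hz => (hg z hz).analyticNear.pderiv j k
    · refine comp_prolong_mem c.eventually_f (g := fun y => pderiv g j k (prolong c.φ y)) ?_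
      filter_upwards [c.eventually_φ, hg'] with z h1 h2
        using (h2.analyticNear.pderiv j k).comp_prolong h1
    · rw [prolong_coord, c.leftInv z hz]
  rw [h]
  exact IsDiffAlong.comp_prolong c.eventually_f c.eventually_φ hg' c.isDiffAlong_matQ

/-- The differential of `f ∘ prolong φ`, which is the order-zero coordinate map on an open set. -/
theorem matT_mul_matQ : c.matT * c.matQ = 1 := by
  refine funext fun k => ?_
  rw [Matrix.mul_apply_eq_vecMul]
  refine ((c.isDiffAlong_comp_prolong fun z hz => c.orderLE_f z hz k).eq_of_eventuallyEq
    c.eventually_f (isDiffAlong_coord_zero k) ?_).trans ?_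
  · exact eventually_trace.2 fun z hz => (c.rightInv z hz).mono fun y hy => hy k
  · funext l
    rw [Matrix.one_apply, Pi.single_apply]
    simp only [eq_comm]

/-- The differential of `F ∘ prolong φ`, which vanishes on an open set because `prolong φ` takes
values in the locus. -/
theorem analyticPolyMatrix_mul_matQ :
    S.analyticPolyMatrix (S.traceFilter (𝓟 N)) * c.matQ = 0 := by
  refine funext fun i => ?_
  rw [Matrix.mul_apply_eq_vecMul, analyticPolyMatrix_row]
  refine (c.isDiffAlong_comp_prolong fun z hz => orderLE_eqn hz.2.1 i).eq_of_eventuallyEq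
    c.eventually_f (g' := fun _ => 0) (w' := 0) ?_ ?_
  · intro j k
    have h (y : Jet m) : pderiv (fun _ : Jet m => (0 : ℝ)) j k y = 0 := by
      simp [pderiv, lineDeriv]
    simp only [h]
    rw [toFn_zero, Pi.zero_apply, map_zero]
  · exact eventually_trace.2 fun z hz => (c.mem_locus z hz).mono fun y hy => hy.2 0 i

/-- Row `i` of `1 - Q T` is the differential of a function that vanishes on the locus, though not
necessarily around it. -/
theorem isDiffAlong_defect (i : Fin n) : IsDiffAlong (S.traceFilter (𝓟 N)) (coord 0)
    (coord 0 i - fun z => c.φ i (prolong c.f z)) (Pi.single i 1 - c.matQ i ᵥ* c.matT) := by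
  have hf : ∀ᶠ z in S.traceFilter (𝓟 N), ∀ k, AnalyticNear (c.f k) (prolong (coord 0) z) := by
    simp only [prolong_coord]
    exact c.eventually_f
  have hφ : ∀ᶠ z in S.traceFilter (𝓟 N),
      OrderLE c.s (c.φ i) (prolong c.f (prolong (coord 0) z)) := by
    simp only [prolong_coord]
    exact eventually_trace.2 fun z hz => c.orderLE_φ z hz i
  have h := IsDiffAlong.comp_prolong eventually_coord hf hφ c.isDiffAlong_matT
  have hrow : (rowOp (S.traceFilter (𝓟 N)) c.s (c.φ i) fun z => prolong c.f (prolong (coord 0) z)) =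
      c.matQ i := by
    simp only [prolong_coord]
    rfl
  rw [hrow] at h
  refine (isDiffAlong_coord_zero i).sub eventually_coord h
    (Eventually.of_forall fun z => analyticNear_coord 0 i _) ?_
  filter_upwards [hf, hφ] with z h1 h2 using h2.analyticNear.comp_prolong h1

/-- The constant matrix `B` over the ring of analytic functions. -/
def constB : Matrix (Fin n) (Fin q) (FnRing (S.traceFilter (𝓟 N))) :=
  Matrix.of fun k s => toFn _ fun _ => c.B k s

/-- The matrix `∂F/∂x⁽ʲ⁾` over the ring of analytic functions. -/
def _root_.ImplicitSystem.analyticPartial (S : ImplicitSystem n q) (L : Filter (Jet n)) (j : ℕ) :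
    Matrix (Fin q) (Fin n) (FnRing L) :=
  Matrix.of fun i k => toFn L (pderiv (S.eqn i) j k)

theorem pderiv_eqn_mem (j : ℕ) (i : Fin q) (k : Fin n) :
    pderiv (S.eqn i) j k ∈ analyticSubring (S.traceFilter (𝓟 N)) :=
  eventually_trace.2 fun _ hz => (S.eqn_mem hz.2.1 i).pderiv j k

theorem isUnit_analyticPartial_mul :
    IsUnit (S.analyticPartial (S.traceFilter (𝓟 N)) 1 * c.constB) := by
  have hmem (i s) : (fun z => (S.leading z * c.B) i s) ∈ analyticSubring (S.traceFilter (𝓟 N)) := by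
    have : (fun z => (S.leading z * c.B) i s) =
        ∑ k, pderiv (S.eqn i) 1 k * fun _ => c.B k s := by
      funext z
      simp [Matrix.mul_apply, leading]
    rw [this]
    exact sum_mem fun k _ => mul_mem (pderiv_eqn_mem 1 i k) (const_mem_analyticSubring _)
  have h : S.analyticPartial (S.traceFilter (𝓟 N)) 1 * c.constB =
      Matrix.of fun i s => toFn (S.traceFilter (𝓟 N)) fun z => (S.leading z * c.B) i s := by
    ext i s
    have : (fun z => (S.leading z * c.B) i s) =
        ∑ k, pderiv (S.eqn i) 1 k * fun _ => c.B k s := by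
      funext z
      simp [Matrix.mul_apply, leading]
    rw [Matrix.of_apply, this, toFn_sum _ fun k _ => mul_mem (pderiv_eqn_mem 1 i k)
      (const_mem_analyticSubring _), Matrix.mul_apply]
    exact Finset.sum_congr rfl fun k _ =>
      (toFn_mul (pderiv_eqn_mem 1 i k) (const_mem_analyticSubring _)).symm
  rw [h]
  exact isUnit_toFn_matrix hmem (eventually_trace.2 c.isUnit_leading)

/-- A row that kills the velocities of the curves in the locus and that is of order zero on the range
of `B` vanishes. -/
theorem eq_zero_of_pairing_eq_zero {w : Fin n → DiffOp (FnRing (S.traceFilter (𝓟 N)))}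
    {a : Fin q → FnRing (S.traceFilter (𝓟 N))}
    (hw : w ᵥ* c.constB.map DiffOp.CHom = fun s => DiffOp.C (a s))
    (hpair : ∀ z (hz : pure z ≤ S.traceFilter (𝓟 N)) (γ : ℝ → Jet n) (v : Jet n), γ 0 = z →
      (∀ j k, HasDerivAt (fun t => γ t j k) (v j k) 0) → (∀ᶠ t in 𝓝 0, γ t ∈ N ∩ S.locus) →
      ∑ k, DiffOp.pairing (FnRing.eval hz) (fun j => v j k) (w k) = 0) : w = 0 := by
  funext k
  refine DiffOp.ext_coeff fun j => ?_
  rw [Pi.zero_apply, map_zero]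
  refine FnRing.eq_zero_of_eval c.isOpen c.tangent
    fun z (hz : pure z ≤ S.traceFilter (𝓟 N)) => ?_
  have hzN : z ∈ N ∩ S.locus := by
    rwa [traceFilter, inf_principal, pure_le_principal] at hz
  let e : ℕ → Fin n → ℝ := fun j k => FnRing.eval hz (DiffOp.coeff j (w k))
  -- `w B` has order zero and `B` is constant, so the coefficients of `w` of order `≥ 1` annihilate
  -- the range of `B`.
  have heB (j : ℕ) (b : Fin q → ℝ) : ∑ k, e (j + 1) k * (c.B *ᵥ b) k = 0 := by
    have h1 (s : Fin q) : ∑ k, e (j + 1) k * c.B k s = 0 := by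
      have h := congrArg (fun x => FnRing.eval hz (DiffOp.coeff (j + 1) (x s))) hw
      simp only [Matrix.vecMul, dotProduct, map_sum, Matrix.map_apply, DiffOp.CHom_apply,
        DiffOp.coeff_C, Nat.succ_ne_zero, if_false, map_zero] at h
      rw [← h]
      refine Finset.sum_congr rfl fun k _ => ?_
      rw [DiffOp.coeff_mul_C_of_deriv_eq_zero (b := c.constB k s) _ (deriv_toFn_const _), map_mul]
      congr 1
      exact (FnRing.eval_toFn hz (const_mem_analyticSubring _)).symm
    simp only [Matrix.mulVec, dotProduct, Finset.mul_sum]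
    rw [Finset.sum_comm]
    refine Finset.sum_eq_zero fun s _ => ?_
    calc ∑ k, e (j + 1) k * (c.B k s * b s) = (∑ k, e (j + 1) k * c.B k s) * b s := by
          rw [Finset.sum_mul]
          exact Finset.sum_congr rfl fun k _ => (mul_assoc _ _ _).symm
      _ = 0 := by rw [h1, zero_mul]
  -- The curve is aimed at the unit jet in direction `(j, k)`. Its velocity differs from it only by
  -- vectors that `w` does not see, so the pairing reads off coefficient `j` of `w k`.
  obtain ⟨γ, v, b, hγ0, hγ, hv0, hv, hloc⟩ := exists_curve_mem_locus hzN.2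
    (c.isUnit_leading z hzN) (Pi.single j (Pi.single k 1))
  have hcont : ContinuousAt γ 0 :=
    continuousAt_pi.2 fun j => continuousAt_pi.2 fun k => (hγ j k).continuousAt
  have hN : ∀ᶠ t in 𝓝 0, γ t ∈ N :=
    hcont.eventually (c.isOpen.mem_nhds (by rw [hγ0]; exact hzN.1))
  have h0 := hpair z hz γ v hγ0 hγ (hN.and hloc)
  choose d hd using fun k => DiffOp.exists_forall_ge_coeff_eq_zero (w k)
  set D := max (j + 1) (Finset.univ.sup d) with hD
  have hterm (k) : DiffOp.pairing (FnRing.eval hz) (fun j => v j k) (w k) =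
      ∑ j ∈ Finset.range D, e j k * v j k :=
    DiffOp.pairing_eq_sum _ _ fun i hi =>
      hd k i ((Finset.le_sup (Finset.mem_univ k)).trans ((le_max_right _ _).trans hi))
  simp only [hterm] at h0
  rw [Finset.sum_comm] at h0
  have hrow (i : ℕ) : ∑ k, e i k * v i k =
      ∑ l, e i l * (Pi.single j (Pi.single k 1) : Jet n) i l := by
    cases i with
    | zero => rw [hv0]
    | succ i =>
      rw [hv]
      simp only [Pi.add_apply, mul_add, Finset.sum_add_distrib]
      rw [heB, add_zero]
  simp only [hrow] at h0
  rw [Finset.sum_eq_single j, Finset.sum_eq_single k] at h0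
  · simp only [Pi.single_eq_same, mul_one] at h0
    exact h0
  · intro l _ hl
    simp [hl]
  · simp
  · intro i _ hi
    refine Finset.sum_eq_zero fun l _ => ?_
    rw [Pi.single_eq_of_ne hi, Pi.zero_apply, mul_zero]
  · intro h
    exact absurd (Finset.mem_range.2 (lt_of_lt_of_le (Nat.lt_succ_self j) (le_max_left _ _))) h

/-- Divide the row of `1 - Q T` by `P`. Both the row and the subtracted multiple of `P` are built
from differentials of functions vanishing on the locus, so the remainder kills the velocities of
curves in the locus and is zero. -/
theorem exists_defect_eq (i : Fin n) :
    ∃ x : Fin q → DiffOp (FnRing (S.traceFilter (𝓟 N))),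
      Pi.single i 1 - c.matQ i ᵥ* c.matT = x ᵥ* S.analyticPolyMatrix (S.traceFilter (𝓟 N)) := by
  obtain ⟨x, a, hx⟩ := DiffOp.exists_vecMul_sub_order_zero
    (P := S.analyticPolyMatrix (S.traceFilter (𝓟 N))) (P₀ := S.analyticPartial _ 0)
    (P₁ := S.analyticPartial _ 1) (B := c.constB) (fun i k => rfl)
    (fun k s => deriv_toFn_const _) c.isUnit_analyticPartial_mul
    (Pi.single i 1 - c.matQ i ᵥ* c.matT)
  refine ⟨x, sub_eq_zero.1 (c.eq_zero_of_pairing_eq_zero hx ?_)⟩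
  intro z hz γ v hγ0 hγ hloc
  have hzN : z ∈ N ∩ S.locus := by
    rwa [traceFilter, inf_principal, pure_le_principal] at hz
  simp only [Pi.sub_apply _ (x ᵥ* _), map_sub, Finset.sum_sub_distrib]
  have hdef : (coord 0 i - fun z => c.φ i (prolong c.f z)) ∈
      analyticSubring (S.traceFilter (𝓟 N)) :=
    sub_mem (mem_analyticSubring.2 (Eventually.of_forall fun z => analyticNear_coord 0 i z))
      (comp_prolong_mem c.eventually_f (c.eventually_φ.mono fun z hz => hz i))
  have h1 := pairing_eq_lineDeriv hdef (c.isDiffAlong_defect i) hz v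
  have h2 : lineDeriv ℝ (coord 0 i - fun z => c.φ i (prolong c.f z)) z v = 0 := by
    refine AnalyticNear.lineDeriv_eq_zero_of_curve hγ0 (eventually_trace.1 hdef z hzN) hγ ?_
    filter_upwards [hloc] with t ht
    have h := congrFun (congrFun (c.leftInv _ ht) 0) i
    rw [Pi.sub_apply, sub_eq_zero]
    exact h.symm
  rw [h1, h2, zero_sub, neg_eq_zero]
  simp only [Matrix.vecMul, dotProduct, map_sum]
  rw [Finset.sum_comm]
  refine Finset.sum_eq_zero fun s _ => ?_
  refine pairing_smul_eq_zero (eventually_trace.2 fun z hz => S.eqn_mem hz.2.1 s)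
    (isDiffAlong_polyMatrix s) hz (fun l => ?_) (x s)
  refine AnalyticNear.lineDeriv_eq_zero_of_curve hγ0 ((S.eqn_mem hzN.2.1 s).cartan_iterate l) hγ ?_
  filter_upwards [hloc] with t ht using ht.2.2 l s

/-- From `W P = 1 - Q T` follow `(P W - 1) P = -P Q T = 0` and `(T W) P = T - T Q T = 0`; then `P`
is cancelled on the right. -/
theorem exists_block_inverse :
    ∃ W : Matrix (Fin n) (Fin q) (DiffOp (FnRing (S.traceFilter (𝓟 N)))),
      S.analyticPolyMatrix (S.traceFilter (𝓟 N)) * W = 1 ∧ c.matT * W = 0 ∧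
      W * S.analyticPolyMatrix (S.traceFilter (𝓟 N)) + c.matQ * c.matT = 1 := by
  choose W hW using c.exists_defect_eq
  set P := S.analyticPolyMatrix (S.traceFilter (𝓟 N)) with hP
  have hWP : Matrix.of W * P = 1 - c.matQ * c.matT := by
    refine funext fun i => ?_
    rw [Matrix.mul_apply_eq_vecMul]
    refine (hW i).symm.trans ?_
    change _ = (1 : Matrix (Fin n) (Fin n) _) i - (c.matQ * c.matT) i
    rw [Matrix.mul_apply_eq_vecMul]
    congr 1
    funext k
    rw [Matrix.one_apply, Pi.single_apply]
    simp only [eq_comm]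
  have hcancel {p : ℕ} (Z : Matrix (Fin p) (Fin q) (DiffOp (FnRing (S.traceFilter (𝓟 N)))))
      (hZ : Z * P = 0) : Z = 0 := by
    refine funext fun i => ?_
    refine DiffOp.eq_zero_of_vecMul_eq_zero (P := P) (P₀ := S.analyticPartial _ 0)
      (P₁ := S.analyticPartial _ 1) (B := c.constB) (fun i k => rfl)
      (fun k s => deriv_toFn_const _) c.isUnit_analyticPartial_mul ?_
    rw [← Matrix.mul_apply_eq_vecMul, hZ]
    rfl
  refine ⟨Matrix.of W, ?_, ?_, ?_⟩
  · rw [← sub_eq_zero]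
    refine hcancel _ ?_
    rw [Matrix.sub_mul, Matrix.mul_assoc, hWP, Matrix.mul_sub, ← Matrix.mul_assoc,
      c.analyticPolyMatrix_mul_matQ, Matrix.zero_mul, Matrix.mul_one, Matrix.one_mul, sub_zero,
      sub_self]
  · refine hcancel _ ?_
    rw [Matrix.mul_assoc, hWP, Matrix.mul_sub, ← Matrix.mul_assoc, c.matT_mul_matQ, Matrix.mul_one,
      Matrix.one_mul, sub_self]
  · rw [hWP, sub_add_cancel]

/-- The homomorphism from the analytic functions on `N ∩ locus` to the meromorphic functions along a
filter contained in `N`. -/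
def toCoeff {l : Filter (Jet n)} (hl : l ≤ 𝓟 N) :
    FnRing (S.traceFilter (𝓟 N)) →+* S.Coeff l :=
  (algebraMap (FnRing (S.traceFilter l)) (S.Coeff l)).comp
    (FnRing.restrict (S.traceFilter_mono hl))

theorem toCoeff_deriv {l : Filter (Jet n)} (hl : l ≤ 𝓟 N) (a : FnRing (S.traceFilter (𝓟 N))) :
    toCoeff hl (a′) = (toCoeff hl a)′ := by
  change algebraMap (FnRing (S.traceFilter l)) (S.Coeff l)
    (FnRing.restrict (S.traceFilter_mono hl) (a′)) = _
  rw [FnRing.restrict_deriv]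
  exact (DifferentialAlgebra.deriv_algebraMap _).symm

theorem analyticPolyMatrix_map {l : Filter (Jet n)} (hl : l ≤ 𝓟 N) :
    (S.analyticPolyMatrix (S.traceFilter (𝓟 N))).map
      (DiffOp.map (toCoeff hl) (toCoeff_deriv hl)) = S.polyMatrix l := by
  have h (j i k) : toCoeff hl (toFn _ (pderiv (S.eqn i) j k)) = S.partialF l j i k := by
    change algebraMap (FnRing (S.traceFilter l)) (S.Coeff l)
      (FnRing.restrict (S.traceFilter_mono hl) (toFn _ _)) = _
    rw [FnRing.restrict_toFn _ (pderiv_eqn_mem j i k), toFn_of_mem]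
    rfl
  ext i k
  simp only [Matrix.map_apply, analyticPolyMatrix, Matrix.of_apply, map_add, map_mul, DiffOp.map_C,
    DiffOp.map_D, h]
  rfl

include c in
-- The five matrix identities are preserved by the ring homomorphism to the operators with
-- meromorphic coefficients, whatever the filter inside `N`.
theorem isControllable_and_isHyperRegular (hn : q + m = n) {l : Filter (Jet n)} (hl : l ≤ 𝓟 N) :
    S.IsControllable l ∧ IsHyperRegular (S.polyMatrix l) := by
  obtain ⟨W, h1, h2, h3⟩ := c.exists_block_inverse
  have h4 := c.analyticPolyMatrix_mul_matQ
  have h5 := c.matT_mul_matQ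
  let H := DiffOp.map (toCoeff hl) (toCoeff_deriv (S := S) hl)
  have e1 := congrArg (fun M => M.map H) h1
  have e2 := congrArg (fun M => M.map H) h2
  have e3 := congrArg (fun M => M.map H) h3
  have e4 := congrArg (fun M => M.map H) h4
  have e5 := congrArg (fun M => M.map H) h5
  simp only [Matrix.map_mul, Matrix.map_add _ (map_add H), Matrix.map_one _ (map_zero H) (map_one H),
    Matrix.map_zero _ (map_zero H)] at e1 e2 e3 e4 e5
  rw [analyticPolyMatrix_map hl] at e1 e3 e4
  exact ⟨free_quotient_of_block_inverse e4 e5 e3, isHyperRegular_of_block_inverse hn e4 e5 e1 e2 e3⟩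

end FlatChart

end ImplicitSystem

/-! ### From local flatness to a flat chart. -/

theorem Matrix.exists_right_inverse_of_rank_eq {q n : ℕ} (A : Matrix (Fin q) (Fin n) ℝ)
    (hA : A.rank = q) : ∃ B : Matrix (Fin n) (Fin q) ℝ, A * B = 1 := by
  have hsurj : Function.Surjective A.mulVecLin := by
    rw [← LinearMap.range_eq_top]
    refine Submodule.eq_top_of_finrank_eq ?_
    rw [Module.finrank_fin_fun]
    exact hA
  obtain ⟨g, hg⟩ := A.mulVecLin.exists_rightInverse_of_surjective (LinearMap.range_eq_top.2 hsurj)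
  refine ⟨LinearMap.toMatrix' g, ?_⟩
  have h := congrArg LinearMap.toMatrix' hg
  rwa [LinearMap.toMatrix'_comp, LinearMap.toMatrix'_id, ← Matrix.toLin'_apply',
    LinearMap.toMatrix'_toLin'] at h

theorem trivialSystem_locus (m : ℕ) : (trivialSystem m).locus = Set.univ :=
  Set.eq_univ_of_forall fun _ => ⟨trivial, fun _ i => i.elim0⟩

namespace ImplicitSystem

open Jet Matrix

variable {n q m : ℕ} {S : ImplicitSystem n q}

section

variable {V : Set (Jet m)} {Φ : Jet m → Jet n}

theorem IsLieBacklundMap.analyticNear (hΦ : (trivialSystem m).IsLieBacklundMap V Φ) {y : Jet m}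
    (hy : y ∈ V) (i : Fin n) : AnalyticNear (fun w => Φ w 0 i) y := by
  obtain ⟨f, hf, h0, -⟩ := hΦ y ⟨hy, by simp [trivialSystem_locus]⟩ 0 i
  rw [trivialSystem_locus, nhdsWithin_univ] at h0
  exact hf.congr (h0.mono fun w hw => hw.symm)

/-- The locus of the trivial system is the whole jet space, so the local representatives coincide
with the components of `Φ` and each component is the Cartan derivative of the preceding one. -/
theorem IsLieBacklundMap.eq_prolong (hΦ : (trivialSystem m).IsLieBacklundMap V Φ)
    (hV : IsOpen V) {y : Jet m} (hy : y ∈ V) : Φ y = prolong (fun i w => Φ w 0 i) y := by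
  have h (j : ℕ) (i : Fin n) : ∀ y ∈ V, cartan^[j] (fun w => Φ w 0 i) y = Φ y j i := by
    induction j with
    | zero => intro y _; rfl
    | succ j ih =>
      intro y hy
      obtain ⟨f, hf, h0, h1⟩ := hΦ y ⟨hy, by simp [trivialSystem_locus]⟩ j i
      rw [trivialSystem_locus, nhdsWithin_univ] at h0 h1
      have h2 : cartan^[j] (fun w => Φ w 0 i) =ᶠ[𝓝 y] f := by
        filter_upwards [hV.mem_nhds hy, h0] with w hw hw'
        rw [ih w hw, hw']
      rw [Function.iterate_succ_apply', (cartan_congr h2).eq_of_nhds, h1.self_of_nhds]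
  funext j i
  exact (h j i y hy).symm

/-- The Cartan field is tangent to a set that is the image of a Lie–Bäcklund map. -/
theorem IsLieBacklundMap.cartanTangentOn (hΦ : (trivialSystem m).IsLieBacklundMap V Φ)
    (hV : IsOpen V) {U Λ : Set (Jet n)} {Ψ : Jet n → Jet m} (hΦΛ : Set.MapsTo Φ V Λ)
    (hΨ : Set.MapsTo Ψ (U ∩ Λ) V) (hinv : Set.LeftInvOn Φ Ψ (U ∩ Λ)) : CartanTangentOn Λ U := by
  intro z hz h hh h0
  have hy := hΨ hz
  have hyz : prolong (fun i w => Φ w 0 i) (Ψ z) = z := by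
    rw [← hΦ.eq_prolong hV hy, hinv hz]
  have hθ : ∀ i, AnalyticNear (fun w => Φ w 0 i) (Ψ z) := fun i => hΦ.analyticNear hy i
  have hcomp := AnalyticNear.cartan_comp_prolong (g := h) (z := Ψ z) (by rwa [hyz]) hθ
  rw [hyz] at hcomp
  rw [← hcomp]
  -- `Φ` takes values in `Λ`, where `h` vanishes near `z`; hence `h ∘ Φ` vanishes on a full
  -- neighborhood, and so does its Cartan derivative.
  have hzero : (fun w => h (prolong (fun i w => Φ w 0 i) w)) =ᶠ[𝓝 (Ψ z)] fun _ => 0 := by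
    have hc := continuousAt_prolong hθ
    rw [ContinuousAt, hyz] at hc
    filter_upwards [hc.eventually (eventually_nhdsWithin_iff.1 h0), hV.mem_nhds hy] with w h1 h2
    refine h1 ?_
    rw [← hΦ.eq_prolong hV h2]
    exact hΦΛ h2
  rw [(cartan_congr hzero).eq_of_nhds, cartan_const]
  rfl

end

/-- The representatives of a component of `Ψ` are determined on the locus only. Two of them differ
by a function vanishing there, and tangency makes their Cartan derivatives agree there too, so the
given `f` determines all orders. -/
theorem IsLieBacklundMap.eq_prolong_of_tangent {U : Set (Jet n)} {Ψ : Jet n → Jet m}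
    (hΨ : S.IsLieBacklundMap U Ψ) (hU : IsOpen U) (htan : CartanTangentOn S.locus U)
    {f : Fin m → Jet n → ℝ} {z : Jet n} (hz : z ∈ U ∩ S.locus) (hf : ∀ k, AnalyticNear (f k) z)
    (hΨf : ∀ k, ∀ᶠ w in 𝓝[S.locus] z, Ψ w 0 k = f k w) : Ψ z = prolong f z := by
  have h (j : ℕ) (k : Fin m) : ∀ᶠ w in 𝓝[S.locus] z, Ψ w j k = cartan^[j] (f k) w := by
    induction j with
    | zero => exact hΨf k
    | succ j ih =>
      obtain ⟨g, hg, h0, h1⟩ := hΨ z hz j k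
      have heq : ∀ᶠ w in 𝓝[S.locus] z, g w - cartan^[j] (f k) w = 0 := by
        filter_upwards [ih, h0] with w hw hw'
        rw [← hw', hw, sub_self]
      filter_upwards [eventually_eventually_nhdsWithin.2 heq, h1, self_mem_nhdsWithin,
        mem_nhdsWithin_of_mem_nhds (hU.mem_nhds hz.1), mem_nhdsWithin_of_mem_nhds hg.eventually,
        mem_nhdsWithin_of_mem_nhds ((hf k).cartan_iterate j).eventually]
        with w hw1 hw2 hw3 hw4 hw5 hw6
      have hw5' : AnalyticNear g w := hw5
      have hw6' : AnalyticNear (cartan^[j] (f k)) w := hw6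
      have hsub : AnalyticNear (g - cartan^[j] (f k)) w := by
        rw [sub_eq_add_neg]
        exact hw5'.add hw6'.neg
      have h2 := htan w ⟨hw4, hw3⟩ _ hsub hw1
      have h3 : cartan (g - cartan^[j] (f k)) w = cartan g w - cartan (cartan^[j] (f k)) w :=
        (HasDerivAt.sub (hw5'.hasLineDerivAt _) (hw6'.hasLineDerivAt _)).deriv
      rw [hw2, Function.iterate_succ_apply', ← sub_eq_zero, ← h3, h2]
  funext j k
  exact (h j k).self_of_nhdsWithin hz.2

/-- The representatives in the definition of flatness may vary with the point and the component.
Fixing those of order zero at `x₀` and prolonging them yields one description of `Φ` and `Ψ` valid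
near `x₀`. -/
theorem IsLocallyFlatAt.exists_flatChart {x₀ : Jet n} (hflat : S.IsLocallyFlatAt m x₀)
    (hreg : S.IsRegularAt x₀) : ∃ N : Set (Jet n), x₀ ∈ N ∧ Nonempty (S.FlatChart m N) := by
  obtain ⟨y₀, hx₀, -, U, V, Φ, Ψ, hU, hxU, hV, hyV, hΦm, hΨm, hΨΦ, hΦΨ, -, hΨx, hΦ, hΨ⟩ := hflat
  rw [trivialSystem_locus, Set.inter_univ] at hΦm hΨm hΨΦ
  have htan : CartanTangentOn S.locus U :=
    hΦ.cartanTangentOn hV (hΦm.mono_right Set.inter_subset_right) hΨm hΦΨ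
  obtain ⟨B, hB⟩ := Matrix.exists_right_inverse_of_rank_eq (S.leading x₀) hreg
  have hB' : IsUnit (S.leading x₀ * B) := hB ▸ isUnit_one
  choose f hf hΨf _ using fun k => hΨ x₀ ⟨hxU, hx₀⟩ 0 k
  let φ : Fin n → Jet m → ℝ := fun i w => Φ w 0 i
  have hx₀y₀ : prolong f x₀ = y₀ := by
    rw [← hΨ.eq_prolong_of_tangent hU htan ⟨hxU, hx₀⟩ hf hΨf, hΨx]
  obtain ⟨r, hr⟩ := exists_forall_orderLE hf
  obtain ⟨s, hs⟩ := exists_forall_orderLE fun i => hΦ.analyticNear hyV i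
  have hcont := continuousAt_prolong hf
  rw [ContinuousAt, hx₀y₀] at hcont
  -- Only finitely many local conditions occur, since the components of positive order are Cartan
  -- derivatives of those of order zero; hence a single neighborhood `N` exists.
  have hev : ∀ᶠ z in 𝓝 x₀, z ∈ U ∧ IsUnit (S.leading z * B) ∧ (∀ k, OrderLE r (f k) z) ∧
      (∀ k, z ∈ S.locus → Ψ z 0 k = f k z) ∧ prolong f z ∈ V ∧
      ∀ i, OrderLE s (φ i) (prolong f z) := by
    filter_upwards [hU.mem_nhds hxU, eventually_isUnit_leading_mul hx₀.1 hB',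
      eventually_all.2 fun k => (hr k).eventually,
      eventually_all.2 fun k => eventually_nhdsWithin_iff.1 (hΨf k), hcont.eventually
      (hV.mem_nhds hyV), hcont.eventually (eventually_all.2 fun i => (hs i).eventually)]
      with z h1 h2 h3 h4 h5 h6 using ⟨h1, h2, h3, h4, h5, h6⟩
  obtain ⟨N, hN, hNo, hxN⟩ := eventually_nhds_iff.1 hev
  have hΨN : ∀ z ∈ N ∩ S.locus, Ψ z = prolong f z := fun z hz =>
    hΨ.eq_prolong_of_tangent hU htan ⟨(hN z hz.1).1, hz.2⟩
      (fun k => ((hN z hz.1).2.2.1 k).analyticNear) fun k => by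
        filter_upwards [self_mem_nhdsWithin, mem_nhdsWithin_of_mem_nhds (hNo.mem_nhds hz.1)]
          with w h1 h2 using (hN w h2).2.2.2.1 k h1
  have hinv : ∀ z ∈ N ∩ S.locus, prolong φ (prolong f z) = z := fun z hz => by
    rw [← hΦ.eq_prolong hV (hN z hz.1).2.2.2.2.1, ← hΨN z hz, hΦΨ ⟨(hN z hz.1).1, hz.2⟩]
  have hnear : ∀ z ∈ N ∩ S.locus, ∀ᶠ y in 𝓝 (prolong f z),
      y ∈ V ∧ Φ y = prolong φ y ∧ prolong φ y ∈ N ∩ S.locus := fun z hz => by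
    have hV' := (hN z hz.1).2.2.2.2.1
    have hc : ContinuousAt (prolong φ) (prolong f z) :=
      continuousAt_prolong fun i => hΦ.analyticNear hV' i
    rw [ContinuousAt, hinv z hz] at hc
    filter_upwards [hV.mem_nhds hV', hc.eventually (hNo.mem_nhds hz.1)] with y h1 h2
    have h3 := hΦ.eq_prolong hV h1
    exact ⟨h1, h3, h2, h3 ▸ (hΦm h1).2⟩
  refine ⟨N, hxN, ⟨{
    φ := φ
    f := f
    r := r
    s := s
    B := B
    isOpen := hNo
    tangent := fun z hz => htan z ⟨(hN z hz.1).1, hz.2⟩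
    isUnit_leading := fun z hz => (hN z hz.1).2.1
    orderLE_f := fun z hz => (hN z hz.1).2.2.1
    orderLE_φ := fun z hz => (hN z hz.1).2.2.2.2.2
    leftInv := hinv
    rightInv := fun z hz => ?_
    mem_locus := fun z hz => ?_ }⟩⟩
  -- `prolong φ y` lies in `N ∩ locus`, where `f` represents the order-zero part of `Ψ`, and `Ψ`
  -- inverts `Φ`.
  · filter_upwards [hnear z hz] with y hy k
    rw [← (hN _ hy.2.2.1).2.2.2.1 k hy.2.2.2, ← hy.2.1, hΨΦ hy.1]
  · filter_upwards [hnear z hz] with y hy using hy.2.2.2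

end ImplicitSystem

end

theorem mainTheorem4 {n m : ℕ} (hmn : m ≤ n) (S : ImplicitSystem n (n - m)) (x₀ : Jet n)
    (hreg : S.IsRegularAt x₀) (hflat : S.IsLocallyFlatAt m x₀) :
    ∃ N : Set (Jet n), IsOpen N ∧ x₀ ∈ N ∧
      (∀ x ∈ N ∩ S.locus,
        S.IsControllable (𝓝 x) ∧ IsHyperRegular (S.polyMatrix (𝓝 x))) ∧
      IsHyperRegular (S.polyMatrix (𝓟 N)) := by
  obtain ⟨N, hxN, ⟨c⟩⟩ := hflat.exists_flatChart hreg
  have hn : n - m + m = n := Nat.sub_add_cancel hmn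
  -- The filters `𝓝 x` and `𝓟 N` both lie below `𝓟 N`, so the same chart covers the germs at every
  -- point and the whole neighborhood.
  exact ⟨N, c.isOpen, hxN,
    fun x hx => c.isControllable_and_isHyperRegular hn (le_principal_iff.2 (c.isOpen.mem_nhds hx.1)),
    (c.isControllable_and_isHyperRegular hn le_rfl).2⟩
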